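/- Let $F$ be a field and let $K=F((t^{-1}))$ be the field of formal Laurent series in $t^{-1}$, with the absolute value given by $|0|=0$ and $|x|=2^{m}$ if $x=\sum_{k\le m}a_kt^{k}$ with $a_m\ne 0$. Regard $F[t]$ as a subset of $K$. For a positive integer $d$, let $\mathbb A_d(K)$ be the set of $\xi\in K$ that are roots of a polynomial $P\in F[t][x]$ of degree $d$ in $x$ which is irreducible over $F(t)$ and has coprime coefficients. This polynomial, unique up to a factor in $F^{\times}$, is the minimal polynomial of $\xi$, and the height $H(\xi)$ is the maximum of the absolute values of its coefficients. For distinct positive integers $d,r$, let $D_{d,r}(K)$ be the set of pairs $(u,v)$ of positive real numbers for which there is a constant $c>0$ such that $$|\xi-\alpha|>\frac{c}{H(\xi)^{u}H(\alpha)^{v}}\qquad\text{for all }\xi\in\mathbb A_d(K),\ \alpha\in\mathbb A_r(K).$$ (a) If $F$ has positive characteristic, then for every integer $d\ge 2$, $$D_{d,1}(K)=\{(u,v)\in\mathbb R^2:\ u\ge 1,\ v\ge d\}.$$ (b) If $F$ has characteristic $0$, then for every real $v_0$ with $2\le v_0\le 3$ the set $D_{3,1}(K)$ meets the line $\{(u,v)\in\mathbb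 R^2: v=v_0\}$, and moreover $(4,2)\in D_{3,1}(K)$. -/

import Mathlib

namespace DistancedSeries

open Polynomial

noncomputable section

/-- The field `K = F((t⁻¹))`. It is realised as the Mathlib field of formal Laurent series over `F`
whose variable stands for `t⁻¹`: the series `∑ aₖ t⁻ᵏ` is the one with `k`-th coefficient `aₖ`. -/
abbrev K (F : Type*) [Field F] : Type _ := LaurentSeries F

/-- The element `t` of `F((t⁻¹))`, the inverse of the variable `t⁻¹`. -/
def t (F : Type*) [Field F] : K F := HahnSeries.single (-1 : ℤ) (1 : F)

/-- The inclusion of `F[t]` in `F((t⁻¹))`, which sends the polynomial variable to `t`. -/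
def incl (F : Type*) [Field F] : F[X] →+* K F :=
  Polynomial.eval₂RingHom (HahnSeries.C : F →+* K F) (t F)

open Classical in
/-- The absolute value on `F((t⁻¹))`: `|0| = 0`, and `|x| = 2 ^ m` if the leading term of `x`
is a nonzero multiple of `t ^ m`. -/
def absVal {F : Type*} [Field F] (x : K F) : ℝ :=
  if x = 0 then 0 else (2 : ℝ) ^ (-HahnSeries.order x)

/-- `P` is a minimal polynomial over `F[t]` of the series `ξ`: it is irreducible as an element
of `F[t][x]` (so its coefficients are coprime, and it is irreducible over `F(t)`), and `ξ` is a
root of it. Such a polynomial is unique up to a factor in `Fˣ`. -/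
structure IsMinimalPolynomial {F : Type*} [Field F] (P : F[X][X]) (ξ : K F) : Prop where
  irreducible : Irreducible P
  root : P.eval₂ (incl F) ξ = 0

/-- The naive height of a polynomial over `F[t]`: the largest absolute value of its
coefficients. The height of an algebraic series is that of its minimal polynomial. -/
def height {F : Type*} [Field F] (P : F[X][X]) : ℝ :=
  (Finset.range (P.natDegree + 1)).sup' Finset.nonempty_range_add_one
    (fun i => absVal (incl F (P.coeff i)))

/-- The set `D_{d,r}(K)`: the pairs `(u,v)` of positive reals such that, for some constant `c > 0`,
`|ξ - α| > c / (H(ξ) ^ u * H(α) ^ v)` for all series `ξ` of degree `d` and `α` of degree `r`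
(with minimal polynomials `P` and `R`). -/
def D (F : Type*) [Field F] (d r : ℕ) : Set (ℝ × ℝ) :=
  {w | 0 < w.1 ∧ 0 < w.2 ∧ ∃ c : ℝ, 0 < c ∧ ∀ (ξ α : K F) (P R : F[X][X]),
    IsMinimalPolynomial P ξ → P.natDegree = d → IsMinimalPolynomial R α → R.natDegree = r →
      c / (height P ^ w.1 * height R ^ w.2) < absVal (ξ - α)}

/-- The horizontal line of second coordinate `v`. -/
def line (v : ℝ) : Set (ℝ × ℝ) := {w | w.2 = v}

end

end DistancedSeries

namespace DistancedSeries

open Polynomial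

/-! ### The absolute value -/

section AbsVal

variable {F : Type*} [Field F]

/-! Liouville's inequality (`liouville`) puts every (u, v) with u ≥ 1 and v ≥ d in the set: clearing
denominators in P(α) leaves a nonzero polynomial in t, of absolute value at least 1.

In characteristic p nothing more is true. The root near t^(-n) of t x^d + t^n x - 1, compared with α
= 0, forces u ≥ 1. For v ≥ d write d = q m with q a power of p and p ∤ m, and let σ = (1 +
t⁻¹)^(-1/m). If p^b = m n + 1, Frobenius shows that σ agrees with r = (1 + t⁻¹)^n to order m n + 1
(`X_pow_dvd_sub_pow`); for q = 1 this settles the matter with the fixed series ξ = σ. For q > 1 take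
ξ with ξ^q - ξ + r = σ^Q, where Q = q^(k+1). The rational function s = ∑_{i ≤ k} r^(q^i) satisfies
s^q - s + r = r^Q, so |ξ - s| ≤ 2^(-(m n + 1) Q), while H(s) ≤ 2^(n q^k) and H(ξ) ≤ 2^(Q + n m).
Taking n large, then k large, gives v ≥ q m. Irreducibility is read off Newton polygons at t = 0 and
t = -1 (`dvd_natDegree_mul_of_gaussNorm_le`).

In characteristic 0 a cubic series satisfies a Riccati equation for θ = t d/dt, with coefficients of
size at most H(ξ)^4 (`riccati_of_root`). If α = p/q does not satisfy it, q² times the defect is a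
nonzero polynomial, and the defect is at most |ξ - α| H(ξ)^4 max(1, |α|). If α does satisfy it, Δ
P(α)² / Hess(α)³, a function of the cross-ratio of α with the three roots of P, is killed by θ and
so has absolute value 1; but it would be small if α were close to ξ (`one_le_abv_sub_of_riccati`).
Either way |ξ - α| H(ξ)^4 H(α)^2 ≥ 1. -/

lemma absVal_of_ne {x : K F} (hx : x ≠ 0) : absVal x = (2 : ℝ) ^ (-HahnSeries.order x) := by
  simp [absVal, hx]

/-- The absolute value on `F((t⁻¹))` as a bundled absolute value. -/
noncomputable def abv (F : Type*) [Field F] : AbsoluteValue (K F) ℝ where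
  toFun := absVal
  map_mul' x y := by
    by_cases hx : x = 0
    · simp [hx, absVal]
    by_cases hy : y = 0
    · simp [hy, absVal]
    rw [absVal_of_ne hx, absVal_of_ne hy, absVal_of_ne (mul_ne_zero hx hy),
      HahnSeries.order_mul hx hy, neg_add, zpow_add₀ two_ne_zero]
  nonneg' x := by
    by_cases hx : x = 0
    · simp [hx, absVal]
    · rw [absVal_of_ne hx]; positivity
  eq_zero' x := by
    constructor
    · intro h
      by_contra hx
      rw [absVal_of_ne hx] at h
      exact (zpow_pos two_pos _).ne' h
    · rintro rfl
      simp [absVal]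
  add_le' x y := by
    by_cases hx : x = 0
    · rw [hx, zero_add, le_add_iff_nonneg_left]; simp [absVal]
    by_cases hy : y = 0
    · rw [hy, add_zero, le_add_iff_nonneg_right]; simp [absVal]
    by_cases hxy : x + y = 0
    · rw [hxy, absVal_of_ne hx, absVal_of_ne hy]
      simp only [absVal, if_true]
      positivity
    · rw [absVal_of_ne hx, absVal_of_ne hy, absVal_of_ne hxy]
      have h := HahnSeries.min_order_le_order_add hxy
      rcases min_le_iff.1 h with h | h
      · have := zpow_le_zpow_right₀ (one_le_two (α := ℝ)) (neg_le_neg h)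
        have := zpow_pos (two_pos (α := ℝ)) (-HahnSeries.order y)
        linarith
      · have := zpow_le_zpow_right₀ (one_le_two (α := ℝ)) (neg_le_neg h)
        have := zpow_pos (two_pos (α := ℝ)) (-HahnSeries.order x)
        linarith

lemma abv_apply (x : K F) : abv F x = absVal x := rfl

lemma abv_of_ne {x : K F} (hx : x ≠ 0) : abv F x = (2 : ℝ) ^ (-HahnSeries.order x) :=
  absVal_of_ne hx

lemma abv_isNonarchimedean : IsNonarchimedean (abv F) := by
  intro x y
  by_cases hx : x = 0
  · simp [hx]
  by_cases hy : y = 0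
  · simp [hy]
  by_cases hxy : x + y = 0
  · rw [hxy, map_zero]
    exact le_max_of_le_left ((abv F).nonneg _)
  rw [abv_of_ne hx, abv_of_ne hy, abv_of_ne hxy, le_max_iff]
  rcases min_le_iff.1 (HahnSeries.min_order_le_order_add hxy) with h | h
  · exact Or.inl (zpow_le_zpow_right₀ one_le_two (neg_le_neg h))
  · exact Or.inr (zpow_le_zpow_right₀ one_le_two (neg_le_neg h))

lemma abv_add_le {x y : K F} {B : ℝ} (hx : abv F x ≤ B) (hy : abv F y ≤ B) :
    abv F (x + y) ≤ B :=
  (abv_isNonarchimedean x y).trans (max_le hx hy)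

lemma abv_sub_le {x y : K F} {B : ℝ} (hx : abv F x ≤ B) (hy : abv F y ≤ B) :
    abv F (x - y) ≤ B := by
  rw [sub_eq_add_neg]
  exact abv_add_le hx (by rwa [(abv F).map_neg])

lemma abv_add_lt {x y : K F} {B : ℝ} (hx : abv F x < B) (hy : abv F y < B) :
    abv F (x + y) < B :=
  (abv_isNonarchimedean x y).trans_lt (max_lt hx hy)

lemma abv_add_eq_left {x y : K F} (h : abv F y < abv F x) : abv F (x + y) = abv F x := by
  rw [abv_isNonarchimedean.add_eq_max_of_ne h.ne']
  exact max_eq_left h.le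

lemma abv_sum_le {ι : Type*} (s : Finset ι) (f : ι → K F) {B : ℝ} (hB : 0 ≤ B)
    (h : ∀ i ∈ s, abv F (f i) ≤ B) : abv F (∑ i ∈ s, f i) ≤ B := by
  classical
  induction s using Finset.induction_on with
  | empty => simpa using hB
  | insert a s ha ih =>
    rw [Finset.sum_insert ha]
    exact abv_add_le (h _ (Finset.mem_insert_self _ _))
      (ih fun i hi => h i (Finset.mem_insert_of_mem hi))

lemma abv_C_le (a : F) : abv F (HahnSeries.C a) ≤ 1 := by
  by_cases h : a = 0
  · simp [h]
  · rw [abv_of_ne (by simpa using h), HahnSeries.order_C]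
    simp

lemma abv_C {a : F} (h : a ≠ 0) : abv F (HahnSeries.C a) = 1 := by
  rw [abv_of_ne (by simpa using h), HahnSeries.order_C]
  simp

lemma abv_natCast_le (n : ℕ) : abv F (n : K F) ≤ 1 := by
  simpa using abv_C_le (n : F)

lemma t_ne_zero : t F ≠ 0 := by
  simp [t]

lemma abv_t : abv F (t F) = 2 := by
  rw [abv_of_ne t_ne_zero, t, HahnSeries.order_single one_ne_zero]
  norm_num

lemma abv_ofPowerSeries_le (f : PowerSeries F) : abv F (HahnSeries.ofPowerSeries ℤ F f) ≤ 1 := by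
  set x : K F := HahnSeries.ofPowerSeries ℤ F f with hx
  by_cases h : x = 0
  · simp [h]
  rw [abv_of_ne h]
  have h1 := (HahnSeries.coeff_order_eq_zero.not.2 h)
  have h2 : 0 ≤ x.order := by
    by_contra hneg
    push Not at hneg
    apply h1
    rw [hx, PowerSeries.coeff_coe, if_pos]
    exact hneg
  calc (2 : ℝ) ^ (-x.order) ≤ 2 ^ (0 : ℤ) := zpow_le_zpow_right₀ one_le_two (by lia)
    _ = 1 := by simp

lemma ofPowerSeries_X : HahnSeries.ofPowerSeries ℤ F PowerSeries.X = (t F)⁻¹ := by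
  rw [HahnSeries.ofPowerSeries_X, eq_comm]
  apply inv_eq_of_mul_eq_one_left
  rw [t, HahnSeries.single_mul_single]
  simp

lemma abv_ofPowerSeries_le_of_dvd {f : PowerSeries F} {n : ℕ} (h : PowerSeries.X ^ n ∣ f) :
    abv F (HahnSeries.ofPowerSeries ℤ F f) ≤ ((2 : ℝ) ^ n)⁻¹ := by
  obtain ⟨g, rfl⟩ := h
  rw [map_mul, map_pow, ofPowerSeries_X, (abv F).map_mul, map_pow, map_inv₀, abv_t, inv_pow]
  exact mul_le_of_le_one_right (by positivity) (abv_ofPowerSeries_le g)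

lemma incl_C (a : F) : incl F (C a) = HahnSeries.C a := by simp [incl]

lemma incl_X : incl F X = t F := by simp [incl]

lemma abv_incl_le {a : F[X]} {n : ℕ} (h : a.natDegree ≤ n) : abv F (incl F a) ≤ 2 ^ n := by
  rw [Polynomial.as_sum_range_C_mul_X_pow a, map_sum]
  refine abv_sum_le _ _ (by positivity) fun i hi => ?_
  rw [map_mul, map_pow, incl_C, incl_X, (abv F).map_mul, map_pow, abv_t]
  have : i ≤ n := by have := Finset.mem_range.1 hi; lia
  calc _ ≤ 1 * (2 : ℝ) ^ i := by gcongr; exact abv_C_le _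
    _ ≤ 2 ^ n := by rw [one_mul]; exact pow_le_pow_right₀ one_le_two this

lemma abv_incl_natDegree {a : F[X]} (h : a ≠ 0) : abv F (incl F a) = 2 ^ a.natDegree := by
  by_cases h0 : a.natDegree = 0
  · rw [Polynomial.eq_C_of_natDegree_eq_zero h0] at h ⊢
    rw [incl_C, abv_C (by simpa using h)]
    simp
  have h1 : a = a.eraseLead + C a.leadingCoeff * X ^ a.natDegree :=
    (a.eraseLead_add_C_mul_X_pow).symm
  have h2 : abv F (incl F (C a.leadingCoeff * X ^ a.natDegree)) = 2 ^ a.natDegree := by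
    rw [map_mul, map_pow, incl_C, incl_X, (abv F).map_mul, map_pow, abv_t,
      abv_C (by simpa using h), one_mul]
  rw [h1, map_add, add_comm, abv_add_eq_left, h2, ← h1]
  · rw [h2]
    refine (abv_incl_le (a.eraseLead_natDegree_le)).trans_lt ?_
    exact pow_lt_pow_right₀ one_lt_two (by lia)

lemma one_le_abv_incl {a : F[X]} (h : a ≠ 0) : 1 ≤ abv F (incl F a) := by
  rw [abv_incl_natDegree h]
  exact one_le_pow₀ one_le_two

lemma incl_injective : Function.Injective (incl F) := by
  rw [injective_iff_map_eq_zero]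
  intro a ha
  by_contra h
  have := one_le_abv_incl h
  rw [ha, map_zero] at this
  linarith

end AbsVal

/-! ### Heights -/

section Height

variable {F : Type*} [Field F] {P : F[X][X]}

lemma abv_coeff_le_height (P : F[X][X]) (i : ℕ) : abv F (incl F (P.coeff i)) ≤ height P := by
  by_cases hi : i < P.natDegree + 1
  · exact Finset.le_sup' (fun i => absVal (incl F (P.coeff i))) (Finset.mem_range.2 hi)
  · rw [coeff_eq_zero_of_natDegree_lt (by lia), map_zero, map_zero]
    exact ((abv F).nonneg (incl F (P.coeff 0))).trans
      (Finset.le_sup' (fun i => absVal (incl F (P.coeff i))) (Finset.mem_range.2 (by lia)))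

lemma height_le {B : ℝ} (h : ∀ i, abv F (incl F (P.coeff i)) ≤ B) : height P ≤ B :=
  Finset.sup'_le _ _ fun i _ => h i

lemma height_le_two_pow {n : ℕ} (h : ∀ i, (P.coeff i).natDegree ≤ n) : height P ≤ 2 ^ n :=
  height_le fun i => abv_incl_le (h i)

lemma one_le_height (h : P ≠ 0) : 1 ≤ height P :=
  (one_le_abv_incl (leadingCoeff_ne_zero.2 h)).trans (abv_coeff_le_height P P.natDegree)

lemma one_le_height_of_irreducible (h : Irreducible P) : 1 ≤ height P := one_le_height h.ne_zero

end Height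

/-! ### Roots of irreducible polynomials over `F[t]` -/

section Irreducible

variable {F : Type*} [Field F] {P : F[X][X]}

/-- The inclusion of `F(t)` in `F((t⁻¹))`. -/
noncomputable def inclFrac (F : Type*) [Field F] : FractionRing F[X] →+* K F :=
  IsFractionRing.lift (incl_injective (F := F))

lemma inclFrac_algebraMap (a : F[X]) : inclFrac F (algebraMap _ _ a) = incl F a :=
  IsFractionRing.lift_algebraMap _ _

lemma eval₂_inclFrac (P : F[X][X]) (x : K F) :
    (P.map (algebraMap F[X] (FractionRing F[X]))).eval₂ (inclFrac F) x = P.eval₂ (incl F) x := by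
  rw [eval₂_map]
  congr 1
  exact RingHom.ext inclFrac_algebraMap

lemma irreducible_map (h : Irreducible P) (hd : P.natDegree ≠ 0) :
    Irreducible (P.map (algebraMap F[X] (FractionRing F[X]))) :=
  (IsPrimitive.irreducible_iff_irreducible_map_fraction_map (h.isPrimitive hd)).1 h

/-- An irreducible polynomial of degree at least two has no root in `F(t)`. -/
lemma eval₂_div_ne_zero (h : Irreducible P) (hd : 2 ≤ P.natDegree) (p q : F[X]) :
    P.eval₂ (incl F) (incl F p / incl F q) ≠ 0 := by
  intro h0
  have hirr := irreducible_map h (by lia)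
  have hroot : (P.map (algebraMap F[X] (FractionRing F[X]))).IsRoot
      (algebraMap _ _ p / algebraMap _ _ q) := by
    apply (inclFrac F).injective
    rw [← eval₂_at_apply, eval₂_inclFrac, map_div₀, inclFrac_algebraMap, inclFrac_algebraMap, h0,
      map_zero]
  have h1 : _ = 1 :=
    natDegree_eq_of_degree_eq_some (degree_eq_one_of_irreducible_of_root hirr hroot)
  rw [natDegree_map_eq_of_injective (IsFractionRing.injective _ _)] at h1
  lia

/-- In characteristic zero an irreducible polynomial has no common root with its derivative. -/
lemma derivative_eval₂_ne_zero [CharZero F] (h : Irreducible P) (hd : P.natDegree ≠ 0) {x : K F}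
    (hx : P.eval₂ (incl F) x = 0) : P.derivative.eval₂ (incl F) x ≠ 0 := by
  have : CharZero (FractionRing F[X]) :=
    charZero_of_injective_algebraMap (R := F[X]) (IsFractionRing.injective _ _)
  obtain ⟨u, v, huv⟩ := (irreducible_map h hd).separable
  intro h0
  have := congrArg (eval₂ (inclFrac F) x) huv
  rw [eval₂_add, eval₂_mul, eval₂_mul, derivative_map, eval₂_inclFrac, eval₂_inclFrac, hx,
    h0] at this
  simp at this

/-- A series of degree one is a quotient of two polynomials. -/
lemma eq_div_of_natDegree_eq_one {R : F[X][X]} {α : K F} (h : R.natDegree = 1)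
    (hα : R.eval₂ (incl F) α = 0) :
    R.coeff 1 ≠ 0 ∧ α = incl F (-R.coeff 0) / incl F (R.coeff 1) := by
  have h1 : R.coeff 1 ≠ 0 := by
    rw [← h]
    exact leadingCoeff_ne_zero.2 (by rintro rfl; simp at h)
  refine ⟨h1, ?_⟩
  have h2 : incl F (R.coeff 1) ≠ 0 := by
    rwa [ne_eq, map_eq_zero_iff _ incl_injective]
  rw [eval₂_eq_sum_range, h] at hα
  simp [Finset.sum_range_succ] at hα
  rw [eq_div_iff h2, map_neg]
  linear_combination hα

end Irreducible

/-! ### The Liouville bound -/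

section Liouville

variable {F : Type*} [Field F] {P R : F[X][X]} {ξ α : K F}

lemma abv_pow_sub_pow_le {x y : K F} {M : ℝ} (hx : abv F x ≤ M) (hy : abv F y ≤ M) (n : ℕ) :
    abv F (x ^ (n + 1) - y ^ (n + 1)) ≤ abv F (x - y) * M ^ n := by
  have hM : 0 ≤ M := ((abv F).nonneg _).trans hx
  rw [← (Commute.all x y).mul_geom_sum₂ (n + 1), (abv F).map_mul]
  gcongr
  refine abv_sum_le _ _ (by positivity) fun i hi => ?_
  rw [(abv F).map_mul, map_pow, map_pow]
  have : n = i + (n + 1 - 1 - i) := by have := Finset.mem_range.1 hi; lia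
  calc _ ≤ M ^ i * M ^ (n + 1 - 1 - i) := by gcongr
    _ = M ^ n := by rw [← pow_add, ← this]

lemma abv_eval₂_sub_le {x y : K F} {M : ℝ} (hM : 1 ≤ M) (hx : abv F x ≤ M) (hy : abv F y ≤ M)
    {d : ℕ} (hd : P.natDegree ≤ d + 1) :
    abv F (P.eval₂ (incl F) x - P.eval₂ (incl F) y) ≤ abv F (x - y) * height P * M ^ d := by
  have hH : 0 ≤ height P := ((abv F).nonneg _).trans (abv_coeff_le_height P 0)
  have h0 : 0 ≤ abv F (x - y) := (abv F).nonneg _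
  rw [eval₂_eq_sum_range, eval₂_eq_sum_range, ← Finset.sum_sub_distrib]
  refine abv_sum_le _ _ (by positivity) fun i hi => ?_
  rw [← mul_sub, (abv F).map_mul]
  rcases i with _ | i
  · simp only [pow_zero, sub_self, map_zero, mul_zero]
    positivity
  · have : i ≤ d := by have := Finset.mem_range.1 hi; lia
    calc _ ≤ height P * (abv F (x - y) * M ^ i) := by
          gcongr
          · exact abv_coeff_le_height _ _
          · exact abv_pow_sub_pow_le hx hy i
      _ ≤ height P * (abv F (x - y) * M ^ d) := by gcongr
      _ = _ := by ring

lemma one_le_abv_pow_mul_eval₂ {d : ℕ} (hd : P.natDegree = d) {p q : F[X]} (hq : q ≠ 0)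
    (h : P.eval₂ (incl F) (incl F p / incl F q) ≠ 0) :
    1 ≤ abv F (incl F q) ^ d * abv F (P.eval₂ (incl F) (incl F p / incl F q)) := by
  have hq' : incl F q ≠ 0 := by rwa [ne_eq, map_eq_zero_iff _ incl_injective]
  have key : incl F q ^ d * P.eval₂ (incl F) (incl F p / incl F q) =
      incl F (∑ i ∈ Finset.range (d + 1), P.coeff i * p ^ i * q ^ (d - i)) := by
    rw [eval₂_eq_sum_range, map_sum, Finset.mul_sum, hd]
    refine Finset.sum_congr rfl fun i hi => ?_
    have : d = (d - i) + i := by have := Finset.mem_range.1 hi; lia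
    rw [map_mul, map_mul, map_pow, map_pow, div_pow]
    conv_lhs => rw [this, pow_add]
    field_simp
  rw [← map_pow, ← (abv F).map_mul, key]
  apply one_le_abv_incl
  intro h0
  rw [h0, map_zero] at key
  exact mul_ne_zero (pow_ne_zero _ hq') h key

/-- With α = p/q the left side is max(|q|, |p|). This is how powers of max(1, |α|) lost in Lipschitz
estimates get absorbed into the height of α. -/
lemma abv_denominator_mul_max_le (hR : R.natDegree = 1) (hα : R.eval₂ (incl F) α = 0) :
    abv F (incl F (R.coeff 1)) * max 1 (abv F α) ≤ height R := by
  obtain ⟨h1, h2⟩ := eq_div_of_natDegree_eq_one hR hα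
  have hq : incl F (R.coeff 1) ≠ 0 := by rwa [ne_eq, map_eq_zero_iff _ incl_injective]
  rw [mul_max_of_nonneg _ _ ((abv F).nonneg _), mul_one, ← (abv F).map_mul]
  have h3 : incl F (R.coeff 1) * α = -incl F (R.coeff 0) := by
    rw [h2, mul_div_cancel₀ _ hq, map_neg]
  rw [h3, (abv F).map_neg]
  exact max_le (abv_coeff_le_height _ _) (abv_coeff_le_height _ _)

lemma one_le_abv_sub_of_lt {x y : K F} (h : max 1 (abv F y) < abv F x) : 1 ≤ abv F (x - y) := by
  obtain ⟨h1, h2⟩ := max_lt_iff.1 h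
  rw [sub_eq_add_neg, abv_add_eq_left (by rwa [(abv F).map_neg])]
  exact h1.le

/-- Liouville's inequality. -/
lemma liouville (hP : IsMinimalPolynomial P ξ) {d : ℕ} (hd : P.natDegree = d) (hd2 : 2 ≤ d)
    (hR : IsMinimalPolynomial R α) (hR1 : R.natDegree = 1) :
    1 ≤ abv F (ξ - α) * (height P * height R ^ d) := by
  have hHP := one_le_height_of_irreducible hP.irreducible
  have hHR := one_le_height_of_irreducible hR.irreducible
  -- If |ξ| exceeds both 1 and |α|, the distance is |ξ| > 1. Otherwise both points lie in the ball
  -- of radius max(1, |α|), where P is Lipschitz.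
  rcases lt_or_ge (max 1 (abv F α)) (abv F ξ) with h | h
  · exact one_le_mul_of_one_le_of_one_le (one_le_abv_sub_of_lt h)
      (one_le_mul_of_one_le_of_one_le hHP (one_le_pow₀ hHR))
  obtain ⟨hq, hα⟩ := eq_div_of_natDegree_eq_one hR1 hR.root
  have hne := eval₂_div_ne_zero hP.irreducible (by lia) (-R.coeff 0) (R.coeff 1)
  have h1 := one_le_abv_pow_mul_eval₂ hd hq hne
  rw [← hα] at h1
  have h2 := abv_eval₂_sub_le (P := P) (d := d - 1) (le_max_left 1 (abv F α)) h (le_max_right _ _)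
    (by lia)
  rw [hP.root, zero_sub, (abv F).map_neg] at h2
  have h3 := abv_denominator_mul_max_le hR1 hR.root
  set M := max 1 (abv F α)
  have hM : 1 ≤ M := le_max_left _ _
  set A := abv F (incl F (R.coeff 1))
  have hA : 0 ≤ A := (abv F).nonneg _
  have hx : 0 ≤ abv F (ξ - α) := (abv F).nonneg _
  calc 1 ≤ A ^ d * (abv F (ξ - α) * height P * M ^ (d - 1)) := h1.trans (by gcongr)
    -- One factor of M ≥ 1 is given away so that A and M carry the same exponent.
    _ ≤ A ^ d * (abv F (ξ - α) * height P * M ^ d) := by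
        gcongr
        lia
    _ = abv F (ξ - α) * (height P * (A * M) ^ d) := by rw [mul_pow]; ring
    _ ≤ _ := by gcongr

end Liouville

/-! ### Polynomials whose Newton polygon at a point of the line is a segment -/

section Newton

variable {F : Type*} [Field F]

open Classical in
/-- The absolute value on `F[t]` attached to the point `r` of the affine line. -/
noncomputable def rootAbv (r : F) : AbsoluteValue F[X] ℝ where
  toFun a := if a = 0 then 0 else (2⁻¹ : ℝ) ^ rootMultiplicity r a
  map_mul' a b := by
    by_cases ha : a = 0
    · simp [ha]
    by_cases hb : b = 0
    · simp [hb]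
    simp only [mul_eq_zero, ha, hb, or_self, if_false]
    rw [rootMultiplicity_mul (mul_ne_zero ha hb), pow_add]
  nonneg' a := by
    split_ifs
    · exact le_rfl
    · positivity
  eq_zero' a := by
    split_ifs with h
    · simp [h]
    · simp [h]
  add_le' a b := by
    by_cases ha : a = 0
    · simp [ha]
    by_cases hb : b = 0
    · simp [hb]
    by_cases hab : a + b = 0
    · simp only [hab, ha, hb, if_true, if_false]
      positivity
    simp only [hab, ha, hb, if_false]
    have h := rootMultiplicity_add (a := r) hab
    rcases min_le_iff.1 h with h | h
    · have := pow_le_pow_of_le_one (a := (2⁻¹ : ℝ)) (by positivity) (by norm_num) h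
      have : (0 : ℝ) < 2⁻¹ ^ rootMultiplicity r b := by positivity
      linarith
    · have := pow_le_pow_of_le_one (a := (2⁻¹ : ℝ)) (by positivity) (by norm_num) h
      have : (0 : ℝ) < 2⁻¹ ^ rootMultiplicity r a := by positivity
      linarith

lemma rootAbv_of_ne (r : F) {a : F[X]} (ha : a ≠ 0) :
    rootAbv r a = (2⁻¹ : ℝ) ^ rootMultiplicity r a := by
  simp [rootAbv, ha]

lemma rootAbv_isNonarchimedean (r : F) : IsNonarchimedean (rootAbv r) := by
  intro a b
  by_cases ha : a = 0
  · simp [ha]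
  by_cases hb : b = 0
  · simp [hb]
  by_cases hab : a + b = 0
  · rw [hab, map_zero]
    exact le_max_of_le_left ((rootAbv r).nonneg _)
  rw [rootAbv_of_ne r ha, rootAbv_of_ne r hb, rootAbv_of_ne r hab, le_max_iff]
  rcases min_le_iff.1 (rootMultiplicity_add (a := r) hab) with h | h
  · exact Or.inl (pow_le_pow_of_le_one (by positivity) (by norm_num) h)
  · exact Or.inr (pow_le_pow_of_le_one (by positivity) (by norm_num) h)

lemma rootAbv_le_one (r : F) (a : F[X]) : rootAbv r a ≤ 1 := by
  by_cases ha : a = 0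
  · simp [ha]
  · rw [rootAbv_of_ne r ha]
    exact pow_le_one₀ (by positivity) (by norm_num)

lemma rootAbv_X_add_C (r : F) : rootAbv (-r) (X + C r) = 2⁻¹ := by
  rw [rootAbv_of_ne _ (X_add_C_ne_zero r)]
  have : X + C r = X - C (-r) := by simp
  rw [this, rootMultiplicity_X_sub_C_self, pow_one]

lemma rootAbv_eq_one {r : F} {a : F[X]} (h : a.eval r ≠ 0) : rootAbv r a = 1 := by
  have ha : a ≠ 0 := by rintro rfl; simp at h
  rw [rootAbv_of_ne r ha, rootMultiplicity_eq_zero (by exact h), pow_zero]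

/-- If the Newton polygon of `P` at `r` is a segment of slope `s / d`, where `d` is the degree of
`P`, then the degree `e` of a factor of `P` is such that `d` divides `e * s`. -/
lemma dvd_natDegree_mul_of_gaussNorm_le (r : F) {P A B : F[X][X]} (hP : P ≠ 0) (hAB : P = A * B)
    {d s : ℕ} (hd : P.natDegree = d) (hd0 : d ≠ 0) (h0 : rootAbv r (P.coeff 0) = 1)
    (hs : rootAbv r P.leadingCoeff = (2⁻¹ : ℝ) ^ s)
    (hg : P.gaussNorm (rootAbv r) ((2 : ℝ) ^ ((s : ℝ) / d)) ≤ 1) :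
    d ∣ A.natDegree * s := by
  -- With this radius the constant and leading terms of P both have weight exactly 1.
  set c : ℝ := (2 : ℝ) ^ ((s : ℝ) / d) with hc
  have hc0 : 0 < c := by positivity
  have hcd : ∀ n : ℕ, (c ^ n) ^ d = 2 ^ (n * s) := by
    intro n
    rw [← pow_mul, mul_comm n d, pow_mul, hc, ← Real.rpow_natCast (2 ^ _) d,
      ← Real.rpow_mul (by norm_num),
      div_mul_cancel₀ _ (by exact_mod_cast hd0), Real.rpow_natCast, ← pow_mul, mul_comm]
  have hA0 : A ≠ 0 := by rintro rfl; simp at hAB; exact hP hAB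
  have hB0 : B ≠ 0 := by rintro rfl; simp at hAB; exact hP hAB
  set v := rootAbv r
  have hmul := gaussNorm_mul (rootAbv_isNonarchimedean r) hc0 A B
  rw [← hAB] at hmul
  have hgA0 := le_gaussNorm v A hc0.le 0
  have hgB0 := le_gaussNorm v B hc0.le 0
  have hgA := le_gaussNorm v A hc0.le A.natDegree
  have hgB := le_gaussNorm v B hc0.le B.natDegree
  rw [pow_zero, mul_one] at hgA0 hgB0
  have e0 : v (A.coeff 0) * v (B.coeff 0) = 1 := by
    rw [← v.map_mul, ← mul_coeff_zero, ← hAB, h0]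
  have hpA : 0 < A.gaussNorm v c := by
    rcases (A.gaussNorm_nonneg v hc0.le).lt_or_eq with h | h
    · exact h
    · exact absurd ((gaussNorm_eq_zero_iff v A (fun _ hx => (AbsoluteValue.eq_zero v).1 hx)
      hc0).1 h.symm) hA0
  have hpB : 0 < B.gaussNorm v c := by
    rcases (B.gaussNorm_nonneg v hc0.le).lt_or_eq with h | h
    · exact h
    · exact absurd ((gaussNorm_eq_zero_iff v B (fun _ hx => (AbsoluteValue.eq_zero v).1 hx)
      hc0).1 h.symm) hB0
  have e1 : (v A.leadingCoeff * c ^ A.natDegree) * (v B.leadingCoeff * c ^ B.natDegree) = 1 := by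
    have h1 : (c ^ A.natDegree) * (c ^ B.natDegree) = 2 ^ s := by
      rw [← pow_add, ← natDegree_mul hA0 hB0, ← hAB, hd, ← Real.rpow_natCast, hc,
        ← Real.rpow_mul (by norm_num), div_mul_cancel₀ _ (by exact_mod_cast hd0), Real.rpow_natCast]
    have h2 : v A.leadingCoeff * v B.leadingCoeff = 2⁻¹ ^ s := by
      rw [← v.map_mul, ← leadingCoeff_mul, ← hAB, hs]
    calc _ = (v A.leadingCoeff * v B.leadingCoeff) * ((c ^ A.natDegree) * (c ^ B.natDegree)) := by
          ring
      _ = 1 := by rw [h1, h2, ← mul_pow]; norm_num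
  -- The Gauss norms of A and B have product at most 1, while their constant terms, and likewise
  -- their leading terms, have weights of product exactly 1. Hence both end terms of A attain its
  -- Gauss norm.
  have squeeze : ∀ {a b a' b' : ℝ}, 0 ≤ a' → 0 ≤ b' → 0 < a → 0 < b → a' ≤ a → b' ≤ b →
      a * b ≤ 1 → a' * b' = 1 → a' = a := by
    intro a b a' b' ha' hb' ha hb h1 h2 h3 h4
    have hb'0 : 0 < b' := by
      rcases hb'.lt_or_eq with h | h
      · exact h
      · rw [← h] at h4; simp at h4
    refine le_antisymm h1 (le_of_mul_le_mul_right ?_ hb'0)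
    calc a * b' ≤ a * b := by gcongr
      _ ≤ a' * b' := h3.trans h4.ge
  have hg' : A.gaussNorm v c * B.gaussNorm v c ≤ 1 := by rw [← hmul]; exact hg
  have q0 := squeeze (v.nonneg _) (v.nonneg _) hpA hpB hgA0 hgB0 hg' e0
  have q1 := squeeze (by have := v.nonneg A.leadingCoeff; positivity)
    (by have := v.nonneg B.leadingCoeff; positivity) hpA hpB hgA hgB hg' e1
  have hlA : A.leadingCoeff ≠ 0 := leadingCoeff_ne_zero.2 hA0
  have hcA : A.coeff 0 ≠ 0 := by
    intro h; rw [h, v.map_zero, zero_mul] at e0; exact zero_ne_one e0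
  rw [← q0, coeff_natDegree] at q1
  change rootAbv r _ * _ = rootAbv r _ at q1
  rw [rootAbv_of_ne r hlA, rootAbv_of_ne r hcA] at q1
  set a := rootMultiplicity r A.leadingCoeff
  set b := rootMultiplicity r (A.coeff 0)
  -- Equality of the two end weights of A, raised to the power d to clear the fractional slope,
  -- reads deg A * s + b * d = a * d.
  have q2 := congrArg (· ^ d) q1
  simp only [mul_pow, hcd, inv_pow, ← pow_mul] at q2
  have q3 : (2 : ℝ) ^ (A.natDegree * s + b * d) = 2 ^ (a * d) := by
    rw [pow_add]
    field_simp at q2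
    linarith
  have q4 := pow_right_injective₀ (two_pos (α := ℝ)) (by norm_num) q3
  exact (Nat.dvd_add_left (Dvd.intro_left b rfl)).1 (q4 ▸ Dvd.intro_left a rfl)

/-- A polynomial none of whose factors has intermediate degree, with coprime leading and constant
coefficients, is irreducible. -/
lemma irreducible_of_natDegree_dvd {P : F[X][X]} (hd : P.natDegree ≠ 0)
    (hcop : IsCoprime P.leadingCoeff (P.coeff 0))
    (h : ∀ A B : F[X][X], P = A * B → P.natDegree ∣ A.natDegree) : Irreducible P := by
  have hP : P ≠ 0 := by rintro rfl; simp at hd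
  -- A factor of degree zero divides both the leading and the constant coefficient.
  have hunit : ∀ A B : F[X][X], P = A * B → A.natDegree = 0 → IsUnit A := by
    intro A B hAB hA
    rw [eq_C_of_natDegree_eq_zero hA] at hAB ⊢
    rw [isUnit_C]
    refine hcop.isUnit_of_dvd' ?_ ?_
    · rw [hAB, leadingCoeff_mul, leadingCoeff_C]; exact Dvd.intro _ rfl
    · rw [hAB, mul_coeff_zero, coeff_C_zero]; exact Dvd.intro _ rfl
  refine ⟨fun hu => hd (natDegree_eq_zero_of_isUnit hu), fun A B hAB => ?_⟩
  by_cases hA : A.natDegree = 0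
  · exact Or.inl (hunit A B hAB hA)
  · right
    refine hunit B A (by rw [hAB, mul_comm]) ?_
    have h1 := Nat.le_of_dvd (Nat.pos_of_ne_zero hA) (h A B hAB)
    have hA0 : A ≠ 0 := by rintro rfl; simp at hA
    have hB0 : B ≠ 0 := by rintro rfl; simp at hAB; exact hP hAB
    rw [hAB, natDegree_mul hA0 hB0] at h1
    lia

end Newton

/-! ### Hensel's lemma for power series -/

section Hensel

variable {F : Type*} [Field F]

lemma exists_root_of_isUnit_derivative (f : (PowerSeries F)[X]) (hf : f.Monic) (a : PowerSeries F)
    (h0 : PowerSeries.X ∣ f.eval a) (h1 : IsUnit (f.derivative.eval a)) :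
    ∃ b, f.eval b = 0 ∧ PowerSeries.X ∣ b - a := by
  obtain ⟨b, hb, hba⟩ := HenselianRing.is_henselian
    (I := Ideal.span {(PowerSeries.X : PowerSeries F)})
    f hf a (Ideal.mem_span_singleton.2 h0) (h1.map _)
  exact ⟨b, hb, Ideal.mem_span_singleton.1 hba⟩

/-- The roots of index prime to the characteristic of a one-unit. -/
lemma exists_pow_mul_eq_one (m : ℕ) (hm : (m : F) ≠ 0) :
    ∃ σ : PowerSeries F, σ ^ m * (1 + PowerSeries.X) = 1 ∧ PowerSeries.X ∣ σ - 1 := by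
  have hm0 : m ≠ 0 := by rintro rfl; simp at hm
  have hu : IsUnit (1 + PowerSeries.X : PowerSeries F) := by
    rw [PowerSeries.isUnit_iff_constantCoeff]; simp
  obtain ⟨u, hu⟩ := hu.exists_left_inv
  obtain ⟨σ, h1, h2⟩ := exists_root_of_isUnit_derivative (X ^ m - C u) (monic_X_pow_sub_C _ hm0) 1
    ⟨u, by simp; linear_combination -hu⟩ (by
      rw [PowerSeries.isUnit_iff_constantCoeff]
      simpa [derivative_X_pow] using hm)
  refine ⟨σ, ?_, h2⟩
  simp [sub_eq_zero] at h1
  rw [h1, hu]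

/-- Modulo X the equation has the simple root 0, its derivative being -1. Since δ (1 - δ^(q - 1)) =
-ε with a unit as second factor, where q = p ^ a, the root δ is as small as ε. -/
lemma exists_artinSchreier_root {p a N : ℕ} [Fact p.Prime] [CharP F p] (ha : a ≠ 0) (hN : N ≠ 0)
    {ε : PowerSeries F} (hε : PowerSeries.X ^ N ∣ ε) :
    ∃ δ : PowerSeries F, δ ^ p ^ a - δ = ε ∧ PowerSeries.X ^ N ∣ δ := by
  have hp : 1 < p ^ a := Nat.one_lt_pow ha (Fact.out : p.Prime).one_lt
  have hX : PowerSeries.X ∣ ε := (dvd_pow_self _ hN).trans hε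
  have hmon : (X ^ p ^ a + (-X - C ε) : (PowerSeries F)[X]).Monic := by
    apply monic_X_pow_add
    have : (-X - C ε : (PowerSeries F)[X]).degree ≤ 1 := by compute_degree
    exact this.trans_lt (by exact_mod_cast hp)
  obtain ⟨δ, h1, h2⟩ := exists_root_of_isUnit_derivative _ hmon 0
    (by simpa [zero_pow (zero_lt_one.trans hp).ne'] using hX) (by
      have : ((p ^ a : ℕ) : PowerSeries F) = 0 := by
        have : ((p ^ a : ℕ) : F) = 0 := by simp [ha]
        rw [← map_natCast (algebraMap F (PowerSeries F)), this, map_zero]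
      simp [derivative_X_pow, this])
  simp only [eval_add, eval_pow, eval_X, eval_sub, eval_neg, eval_C] at h1
  refine ⟨δ, by linear_combination h1, ?_⟩
  rw [sub_zero] at h2
  have hu : IsUnit (1 - δ ^ (p ^ a - 1)) := by
    rw [PowerSeries.isUnit_iff_constantCoeff]
    rw [PowerSeries.X_dvd_iff] at h2
    simp [h2, (show p ^ a - 1 ≠ 0 by lia)]
  have h3 : ε = -(δ * (1 - δ ^ (p ^ a - 1))) := by
    have : δ ^ p ^ a = δ * δ ^ (p ^ a - 1) := by
      rw [← pow_succ']; congr 1; lia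
    rw [mul_sub, ← this]; linear_combination -h1
  rw [h3, dvd_neg] at hε
  exact (hu.dvd_mul_right).1 hε

/-- A root of index `m` of `1 / (1 + X)` is close to a power of `1 + X`. -/
lemma X_pow_dvd_sub_pow {p b m n : ℕ} [Fact p.Prime] [CharP F p] (hn : p ^ b = m * n + 1)
    {σ : PowerSeries F} (hσ : σ ^ m * (1 + PowerSeries.X) = 1) (h1 : PowerSeries.X ∣ σ - 1) :
    PowerSeries.X ^ (p ^ b) ∣ σ - (1 + PowerSeries.X) ^ n := by
  have : CharP (PowerSeries F) p :=
    charP_of_injective_algebraMap (algebraMap F (PowerSeries F)).injective p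
  have hr : σ ^ (m * n) * (1 + PowerSeries.X) ^ n = 1 := by rw [pow_mul, ← mul_pow, hσ, one_pow]
  -- By Frobenius this power is σ^(m n + 1) - 1, and σ^(m n) is the inverse of (1 + X)^n.
  have h2 : PowerSeries.X ^ (p ^ b) ∣ (σ - 1) ^ p ^ b := pow_dvd_pow_of_dvd h1 _
  rw [sub_pow_char_pow, one_pow, hn, pow_succ σ] at h2
  have h3 : σ ^ (m * n) * σ - 1 = σ ^ (m * n) * (σ - (1 + PowerSeries.X) ^ n) := by
    rw [mul_sub, hr]
  rw [h3] at h2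
  rw [hn]
  exact ((IsUnit.of_mul_eq_one _ hr).dvd_mul_left).1 h2

/-- Frobenius shifts the sum by one term, so the difference telescopes. The sum will be the rational
approximation to an Artin–Schreier root. -/
lemma sum_pow_char_pow_sub {A : Type*} [CommRing A] {p : ℕ} [Fact p.Prime] [CharP A p] (a : ℕ)
    (r : A) (k : ℕ) :
    (∑ i ∈ Finset.range k, r ^ (p ^ a) ^ i) ^ p ^ a - ∑ i ∈ Finset.range k, r ^ (p ^ a) ^ i =
      r ^ (p ^ a) ^ k - r := by
  induction k with
  | zero => simp [(Fact.out : p.Prime).ne_zero]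
  | succ k ih =>
    rw [Finset.sum_range_succ, add_pow_char_pow, ← pow_mul, ← pow_succ]
    linear_combination ih

end Hensel

/-! ### Degrees of coefficients -/

section CoeffDegree

variable {F : Type*} [Field F] {P Q : F[X][X]} {m n : ℕ}

/-- All coefficients of `P` have degree at most `n`. -/
def CoeffNatDegreeLE (n : ℕ) (P : F[X][X]) : Prop := ∀ i, (P.coeff i).natDegree ≤ n

lemma CoeffNatDegreeLE.add (hP : CoeffNatDegreeLE n P) (hQ : CoeffNatDegreeLE n Q) :
    CoeffNatDegreeLE n (P + Q) := fun i => by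
  rw [coeff_add]
  exact natDegree_add_le_of_degree_le (hP i) (hQ i)

lemma CoeffNatDegreeLE.sub (hP : CoeffNatDegreeLE n P) (hQ : CoeffNatDegreeLE n Q) :
    CoeffNatDegreeLE n (P - Q) := fun i => by
  rw [coeff_sub]
  exact (natDegree_sub_le_of_le (hP i) (hQ i)).trans (max_self n).le

lemma CoeffNatDegreeLE.mul (hP : CoeffNatDegreeLE m P) (hQ : CoeffNatDegreeLE n Q) :
    CoeffNatDegreeLE (m + n) (P * Q) := fun i => by
  rw [coeff_mul]
  exact natDegree_sum_le_of_forall_le _ _ fun j _ => natDegree_mul_le_of_le (hP _) (hQ _)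

lemma CoeffNatDegreeLE.of_C {a : F[X]} (h : a.natDegree ≤ n) : CoeffNatDegreeLE n (C a) :=
  fun i => by
    rw [coeff_C]
    split_ifs
    · exact h
    · simp

lemma CoeffNatDegreeLE.X_pow (j : ℕ) : CoeffNatDegreeLE 0 (X ^ j : F[X][X]) := fun i => by
  rw [coeff_X_pow]
  split_ifs <;> simp

lemma CoeffNatDegreeLE.pow (hP : CoeffNatDegreeLE n P) (j : ℕ) :
    CoeffNatDegreeLE (n * j) (P ^ j) := by
  induction j with
  | zero => simpa using CoeffNatDegreeLE.X_pow (F := F) 0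
  | succ j ih => rw [pow_succ, mul_add_one]; exact ih.mul hP

lemma CoeffNatDegreeLE.C_mul_X_pow {a : F[X]} (h : a.natDegree ≤ n) (j : ℕ) :
    CoeffNatDegreeLE n (C a * X ^ j) :=
  (CoeffNatDegreeLE.of_C h).mul (CoeffNatDegreeLE.X_pow j)

lemma CoeffNatDegreeLE.C_mul_X {a : F[X]} (h : a.natDegree ≤ n) :
    CoeffNatDegreeLE n (C a * X) := by
  simpa using CoeffNatDegreeLE.C_mul_X_pow h 1

lemma isMinimalPolynomial_linear {p q : F[X]} (hq : q ≠ 0) (h : IsCoprime q p) :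
    (C q * X - C p).natDegree = 1 ∧
      IsMinimalPolynomial (C q * X - C p) (incl F p / incl F q) := by
  have h1 : (C q * X - C p).natDegree = 1 := by
    rw [sub_eq_add_neg, ← C_neg]; exact natDegree_linear hq
  refine ⟨h1, irreducible_of_natDegree_dvd (by lia) ?_ (by simp [h1]), ?_⟩
  · rw [leadingCoeff, h1]
    simpa [coeff_C] using h.neg_right
  · have : incl F q ≠ 0 := by rwa [ne_eq, map_eq_zero_iff _ incl_injective]
    simp [eval₂_sub, mul_div_cancel₀ _ this]

/-- Base 2 logarithms turn membership into a bound, uniform in ξ and α, that is linear in the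
exponents. A necessary condition on w then follows from examples violating this bound. -/
lemma exists_lt_of_mem_D {d : ℕ} {w : ℝ × ℝ} (hw : w ∈ D F d 1) :
    ∃ c : ℝ, ∀ (ξ α : K F) (P R : F[X][X]) (a b N : ℕ), IsMinimalPolynomial P ξ →
      P.natDegree = d → IsMinimalPolynomial R α → R.natDegree = 1 → CoeffNatDegreeLE a P →
      CoeffNatDegreeLE b R → abv F (ξ - α) ≤ ((2 : ℝ) ^ N)⁻¹ →
      c < w.1 * a + w.2 * b - N := by
  obtain ⟨hu, hv, c, hc, h⟩ := hw
  refine ⟨Real.logb 2 c, fun ξ α P R a b N hP hPd hR hRd ha hb hN => ?_⟩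
  have h1 := h ξ α P R hP hPd hR hRd
  have hHP := one_le_height_of_irreducible hP.irreducible
  have hHR := one_le_height_of_irreducible hR.irreducible
  have hHPa := height_le_two_pow ha
  have hHRb := height_le_two_pow hb
  rw [div_lt_iff₀ (by positivity), ← abv_apply] at h1
  rw [Real.logb_lt_iff_lt_rpow one_lt_two hc]
  refine h1.trans_le ?_
  calc _ ≤ ((2 : ℝ) ^ N)⁻¹ * (((2 : ℝ) ^ a) ^ w.1 * ((2 : ℝ) ^ b) ^ w.2) := by
        gcongr
    _ = 2 ^ (w.1 * a + w.2 * b - N) := by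
        rw [← Real.rpow_natCast 2 a, ← Real.rpow_natCast 2 b, ← Real.rpow_natCast 2 N,
          ← Real.rpow_mul two_pos.le, ← Real.rpow_mul two_pos.le, ← Real.rpow_neg two_pos.le,
          ← Real.rpow_add two_pos, ← Real.rpow_add two_pos]
        congr 1
        ring

end CoeffDegree

/-! ### Gauss norms at a point of the line -/

section GaussNorm

variable {F : Type*} [Field F] {r : F} {c : ℝ}

lemma gaussNorm_add_le (hc : 0 < c) {B : ℝ} {P Q : F[X][X]} (hP : P.gaussNorm (rootAbv r) c ≤ B)
    (hQ : Q.gaussNorm (rootAbv r) c ≤ B) : (P + Q).gaussNorm (rootAbv r) c ≤ B :=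
  (isNonarchimedean_gaussNorm _ (rootAbv_isNonarchimedean r) hc.le P Q).trans (max_le hP hQ)

lemma gaussNorm_neg_C (a : F[X]) : (-C a).gaussNorm (rootAbv r) c = rootAbv r a := by
  rw [← C_neg, gaussNorm_C, (rootAbv r).map_neg]

lemma gaussNorm_C_mul_X_pow (a : F[X]) (j : ℕ) :
    (C a * X ^ j).gaussNorm (rootAbv r) c = rootAbv r a * c ^ j := by
  rw [C_mul_X_pow_eq_monomial, gaussNorm_monomial]

lemma gaussNorm_pow (hc : 0 < c) (P : F[X][X]) (j : ℕ) :
    (P ^ j).gaussNorm (rootAbv r) c = P.gaussNorm (rootAbv r) c ^ j := by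
  induction j with
  | zero => rw [pow_zero, pow_zero, ← C_1, gaussNorm_C, (rootAbv r).map_one]
  | succ j ih => rw [pow_succ, pow_succ, gaussNorm_mul (rootAbv_isNonarchimedean r) hc, ih]

lemma rootAbv_X : rootAbv (0 : F) X = 2⁻¹ := by
  simpa using rootAbv_X_add_C (0 : F)

lemma rootAbv_one_add_X : rootAbv (-1 : F) (1 + X) = 2⁻¹ := by
  simpa [add_comm] using rootAbv_X_add_C (1 : F)

lemma isCoprime_one_add_X_X : IsCoprime (1 + X : F[X]) X := ⟨1, -1, by ring⟩

end GaussNorm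

/-! ### Small series of large height -/

section Small

variable {F : Type*} [Field F]

/-- Eisenstein at t = 0 for the reversed polynomial: the Newton polygon is a single segment of slope
1/d, and n ≠ 0 keeps the middle term on the right side of it. -/
lemma irreducible_small {d n : ℕ} (hd : 2 ≤ d) (hn : n ≠ 0) :
    (C X * X ^ d + (C (X ^ n) * X - C 1) : F[X][X]).natDegree = d ∧
      Irreducible (C X * X ^ d + (C (X ^ n) * X - C 1) : F[X][X]) := by
  have hl : (C (X ^ n) * X - C 1 : F[X][X]).natDegree < (C X * X ^ d : F[X][X]).natDegree := by
    rw [natDegree_C_mul_X_pow _ _ X_ne_zero]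
    have : (C (X ^ n) * X - C 1 : F[X][X]).natDegree ≤ 1 := by compute_degree
    lia
  set P : F[X][X] := C X * X ^ d + (C (X ^ n) * X - C 1) with hP
  have hdeg : P.natDegree = d := by
    rw [hP, natDegree_add_eq_left_of_natDegree_lt hl, natDegree_C_mul_X_pow _ _ X_ne_zero]
  have hlead : P.leadingCoeff = X := by
    rw [hP, leadingCoeff_add_of_degree_lt' (degree_lt_degree hl), leadingCoeff_mul, leadingCoeff_C,
      leadingCoeff_X_pow, mul_one]
  have h0 : P.coeff 0 = -1 := by
    simp [hP, coeff_X_pow, (show 0 ≠ d by lia)]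
  have hP0 : P ≠ 0 := by rintro h; rw [h] at hdeg; simp at hdeg; lia
  refine ⟨hdeg, irreducible_of_natDegree_dvd (by lia) (by
    rw [h0]; exact isCoprime_one_right.neg_right) fun A B hAB => ?_⟩
  have hc : (0 : ℝ) < 2 ^ (((1 : ℕ) : ℝ) / d) := by positivity
  have hcd : ((2 : ℝ) ^ (((1 : ℕ) : ℝ) / d)) ^ d = 2 := by
    rw [← Real.rpow_natCast, ← Real.rpow_mul two_pos.le,
      div_mul_cancel₀ _ (by norm_cast; lia)]
    simp
  have hc1 : (1 : ℝ) ≤ 2 ^ (((1 : ℕ) : ℝ) / d) := Real.one_le_rpow one_le_two (by positivity)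
  have := dvd_natDegree_mul_of_gaussNorm_le (s := 1) (0 : F) hP0 hAB hdeg (by lia)
    (by rw [h0, (rootAbv (0 : F)).map_neg, (rootAbv (0 : F)).map_one])
    (by rw [hlead, rootAbv_X, pow_one]) ?_
  · rwa [mul_one, ← hdeg] at this
  set c : ℝ := 2 ^ (((1 : ℕ) : ℝ) / d)
  have hc2 : c ≤ 2 := by rw [← hcd]; exact le_self_pow₀ hc1 (by lia)
  refine gaussNorm_add_le hc ?_ ?_
  · rw [gaussNorm_C_mul_X_pow, rootAbv_X, hcd]; norm_num
  · rw [sub_eq_add_neg]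
    refine gaussNorm_add_le hc ?_ ?_
    · have := gaussNorm_C_mul_X_pow (r := (0 : F)) (c := c) (X ^ n) 1
      rw [pow_one] at this
      rw [this, map_pow, rootAbv_X, pow_one]
      calc (2⁻¹ : ℝ) ^ n * c ≤ 2⁻¹ * 2 := by
            gcongr
            exact pow_le_of_le_one (by norm_num) (by norm_num) hn
        _ = 1 := by norm_num
    · rw [gaussNorm_neg_C]; exact rootAbv_le_one _ _

lemma exists_small_root {d n : ℕ} (hd : 2 ≤ d) (hn : n ≠ 0) :
    ∃ ξ : K F, (C X * X ^ d + (C (X ^ n) * X - C 1) : F[X][X]).eval₂ (incl F) ξ = 0 ∧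
      abv F ξ ≤ ((2 : ℝ) ^ n)⁻¹ := by
  have hnd : 2 ≤ n * d := le_trans hd (Nat.le_mul_of_pos_left d (by lia))
  have hX : (PowerSeries.X : PowerSeries F) ∣ PowerSeries.X ^ (n * d - 1) :=
    dvd_pow_self _ (by lia)
  obtain ⟨g, hg⟩ : ∃ g : PowerSeries F, g = PowerSeries.X ^ (n * d - 1) := ⟨_, rfl⟩
  rw [← hg] at hX
  -- Putting x = t^(-n) z gives t^(1 - n d) z^d + z - 1 = 0. The equation for w = 1/z is monic and
  -- has the simple root 1 modulo t⁻¹, so Hensel's lemma applies.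
  have hmon : (X ^ d + (-X ^ (d - 1) - C g) : (PowerSeries F)[X]).Monic := by
    apply monic_X_pow_add
    have : (-X ^ (d - 1) - C g : (PowerSeries F)[X]).degree ≤ ((d - 1 : ℕ) : WithBot ℕ) := by
      compute_degree
      exact le_rfl
    exact this.trans_lt (by exact_mod_cast (by lia))
  obtain ⟨w, h1, h2⟩ := exists_root_of_isUnit_derivative _ hmon 1
    (by simpa [show (1 : PowerSeries F) + (-1 - g) = -g by ring] using hX) (by
    have : ((d : PowerSeries F) - (d - 1 : ℕ)) = 1 := by
      rw [Nat.cast_sub (by lia)]; simp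
    simp [derivative_X_pow, ← sub_eq_add_neg, this])
  rw [hg] at h1
  have hw : IsUnit w := by
    rw [PowerSeries.X_dvd_iff] at h2
    rw [PowerSeries.isUnit_iff_constantCoeff]
    simp [sub_eq_zero] at h2
    simp [h2]
  obtain ⟨z, hz⟩ := hw.exists_right_inv
  have h3 : z - 1 + PowerSeries.X ^ (n * d - 1) * z ^ d = 0 := by
    simp only [eval_add, eval_pow, eval_X, eval_sub, eval_neg, eval_C] at h1
    have e1 : w ^ d * z ^ d = 1 := by rw [← mul_pow, hz, one_pow]
    have e2 : w ^ (d - 1) * z ^ d = z := by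
      have : d = (d - 1) + 1 := by lia
      conv_lhs => rw [this, pow_succ z, Nat.add_sub_cancel, ← mul_assoc, ← mul_pow, hz]
      simp
    linear_combination (-z ^ d) * h1 + e1 - e2
  refine ⟨HahnSeries.ofPowerSeries ℤ F (PowerSeries.X ^ n * z), ?_,
    abv_ofPowerSeries_le_of_dvd (Dvd.intro _ rfl)⟩
  have h4 := congrArg (HahnSeries.ofPowerSeries ℤ F) h3
  have ht := t_ne_zero (F := F)
  simp only [map_add, map_sub, map_mul, map_pow, ofPowerSeries_X, map_one, map_zero] at h4
  simp only [eval₂_add, eval₂_mul, eval₂_sub, eval₂_C, eval₂_pow, eval₂_X, map_mul, map_pow,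
    ofPowerSeries_X, incl_X, map_one, eval₂_one]
  set y := HahnSeries.ofPowerSeries ℤ F z
  have e : t F * (t F)⁻¹ ^ (n * d) = (t F)⁻¹ ^ (n * d - 1) := by
    conv_lhs => rw [show n * d = (n * d - 1) + 1 by lia, pow_succ]
    field_simp
  have e' : t F ^ n * (t F)⁻¹ ^ n = 1 := by rw [← mul_pow, mul_inv_cancel₀ ht, one_pow]
  rw [mul_pow, ← pow_mul]
  linear_combination h4 + y ^ d * e + y * e'

/-- The small root has |ξ| ≤ 2^(-n) and H(ξ) ≤ 2^n, and α = 0 has height 1; letting n grow forces u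
≥ 1. -/
lemma one_le_fst_of_mem_D {d : ℕ} (hd : 2 ≤ d) {w : ℝ × ℝ} (hw : w ∈ D F d 1) : 1 ≤ w.1 := by
  obtain ⟨c, hc⟩ := exists_lt_of_mem_D hw
  by_contra! hlt
  obtain ⟨N, hN⟩ := exists_nat_gt ((-c) / (1 - w.1))
  rw [div_lt_iff₀ (by linarith)] at hN
  set n := N + 1
  obtain ⟨ξ, hξ, habs⟩ := exists_small_root (F := F) hd (show n ≠ 0 by lia)
  obtain ⟨h1, h2⟩ := irreducible_small (F := F) hd (show n ≠ 0 by lia)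
  obtain ⟨h3, h4⟩ := isMinimalPolynomial_linear (F := F) (p := 0) one_ne_zero isCoprime_one_left
  have := hc ξ _ _ _ n 0 n ⟨h2, hξ⟩ h1 h4 h3
    ((CoeffNatDegreeLE.C_mul_X_pow (by rw [natDegree_X]; lia) d).add
      ((CoeffNatDegreeLE.C_mul_X (by simp)).sub (CoeffNatDegreeLE.of_C (by simp))))
    ((CoeffNatDegreeLE.C_mul_X (by simp)).sub (CoeffNatDegreeLE.of_C (by simp)))
    (by simpa using habs)
  have hn : (n : ℝ) = N + 1 := by simp [n]
  rw [hn] at this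
  simp at this
  nlinarith

end Small

/-! ### Well approximable series in positive characteristic -/

section Approximable

variable {F : Type*} [Field F]

lemma ofPowerSeries_one_add_X :
    HahnSeries.ofPowerSeries ℤ F (1 + PowerSeries.X) = incl F (1 + X) / incl F X := by
  have ht := t_ne_zero (F := F)
  rw [map_add, map_one, ofPowerSeries_X, map_add, map_one, incl_X]
  field_simp
  ring

lemma exists_large_quotient {p m : ℕ} (hp : p.Prime) (hm : ¬ p ∣ m) (N : ℕ) :
    ∃ n b : ℕ, N ≤ n ∧ b ≠ 0 ∧ p ^ b = m * n + 1 := by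
  have hm0 : m ≠ 0 := by rintro rfl; simp at hm
  have hcop : Nat.Coprime p m := (Nat.Prime.coprime_iff_not_dvd hp).2 hm
  -- A multiple of φ(m) gives p^b ≡ 1 modulo m; the second factor makes the quotient (p^b - 1)/m at
  -- least N.
  set b := m.totient * (m * (N + 1)) with hb
  have hbpos : m * (N + 1) ≤ b := Nat.le_mul_of_pos_left _ (Nat.totient_pos.2 (by lia))
  have h1 : p ^ b ≡ 1 [MOD m] := by
    rw [hb, pow_mul]
    simpa using (Nat.ModEq.pow_totient hcop).pow (m * (N + 1))
  have h2 : b < p ^ b := Nat.lt_pow_self hp.one_lt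
  have h3 : m ∣ p ^ b - 1 := (Nat.modEq_iff_dvd' (Nat.one_le_pow _ _ hp.pos)).1 h1.symm
  obtain ⟨n, hn⟩ := h3
  refine ⟨n, b, ?_, ?_, by lia⟩
  · have : m * (N + 1) ≤ m * n := by lia
    have := Nat.le_of_mul_le_mul_left this (by lia)
    lia
  · have : 0 < m * (N + 1) := by positivity
    lia

/-- At t = -1 the leading coefficient has a simple zero and the constant one none, so the Newton
polygon has slope 1/d. -/
lemma irreducible_one_add_X_mul_X_pow {d : ℕ} (hd : d ≠ 0) :
    (C (1 + X) * X ^ d - C X : F[X][X]).natDegree = d ∧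
      Irreducible (C (1 + X) * X ^ d - C X : F[X][X]) := by
  have hX1 : (1 + X : F[X]) ≠ 0 := by rw [add_comm, ← C_1]; exact X_add_C_ne_zero 1
  have hl : (-C (X : F[X]) : F[X][X]).natDegree < (C (1 + X) * X ^ d : F[X][X]).natDegree := by
    rw [natDegree_C_mul_X_pow _ _ hX1, ← C_neg, natDegree_C]
    lia
  rw [sub_eq_add_neg]
  set P : F[X][X] := C (1 + X) * X ^ d + -C (X : F[X]) with hP
  have hdeg : P.natDegree = d := by
    rw [hP, natDegree_add_eq_left_of_natDegree_lt hl, natDegree_C_mul_X_pow _ _ hX1]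
  have hlead : P.leadingCoeff = 1 + X := by
    rw [hP, leadingCoeff_add_of_degree_lt' (degree_lt_degree hl), leadingCoeff_mul, leadingCoeff_C,
      leadingCoeff_X_pow, mul_one]
  have h0 : P.coeff 0 = -X := by
    simp [hP, coeff_X_pow, (show 0 ≠ d by lia)]
  have hP0 : P ≠ 0 := by rintro h; rw [h] at hdeg; simp at hdeg; lia
  refine ⟨hdeg, irreducible_of_natDegree_dvd (by lia) (by
    rw [h0, hlead]; exact isCoprime_one_add_X_X.neg_right) fun A B hAB => ?_⟩
  have hc : (0 : ℝ) < 2 ^ (((1 : ℕ) : ℝ) / d) := by positivity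
  have hcd : ((2 : ℝ) ^ (((1 : ℕ) : ℝ) / d)) ^ d = 2 := by
    rw [← Real.rpow_natCast, ← Real.rpow_mul two_pos.le,
      div_mul_cancel₀ _ (by norm_cast)]
    simp
  have := dvd_natDegree_mul_of_gaussNorm_le (s := 1) (-1 : F) hP0 hAB hdeg hd
    (by rw [h0]; exact rootAbv_eq_one (by simp))
    (by rw [hlead, rootAbv_one_add_X, pow_one]) ?_
  · rwa [mul_one, ← hdeg] at this
  refine gaussNorm_add_le hc ?_ ?_
  · rw [gaussNorm_C_mul_X_pow, rootAbv_one_add_X, hcd]; norm_num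
  · rw [gaussNorm_neg_C]; exact rootAbv_le_one _ _

/-- The fixed series (1 + t⁻¹)^(-1/d) lies within 2^(-(d n + 1)) of ((1 + t)/t)^n, of height at most
2^n, for arbitrarily large n. -/
lemma le_snd_of_mem_D_of_not_dvd {p : ℕ} [Fact p.Prime] [CharP F p] {d : ℕ} (hd : ¬ p ∣ d)
    {w : ℝ × ℝ} (hw : w ∈ D F d 1) : (d : ℝ) ≤ w.2 := by
  obtain ⟨c, hc⟩ := exists_lt_of_mem_D hw
  have hd0 : d ≠ 0 := by rintro rfl; simp at hd
  by_contra! hlt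
  obtain ⟨N, hN⟩ := exists_nat_gt ((w.1 - c) / (d - w.2))
  obtain ⟨n, b, hNn, -, hn⟩ := exists_large_quotient (Fact.out : p.Prime) hd N
  have hN' : (w.1 - c) / (d - w.2) < n := hN.trans_le (by exact_mod_cast hNn)
  rw [div_lt_iff₀ (by linarith)] at hN'
  obtain ⟨σ, hσ, hσ1⟩ := exists_pow_mul_eq_one (F := F) d
    (by rwa [ne_eq, CharP.cast_eq_zero_iff F p])
  have hdvd := X_pow_dvd_sub_pow hn hσ hσ1
  have habs := abv_ofPowerSeries_le_of_dvd hdvd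
  obtain ⟨h1, h2⟩ := irreducible_one_add_X_mul_X_pow (F := F) hd0
  have hXn : (X ^ n : F[X]) ≠ 0 := pow_ne_zero _ X_ne_zero
  obtain ⟨h3, h4⟩ := isMinimalPolynomial_linear hXn
    ((isCoprime_one_add_X_X (F := F)).symm.pow (m := n) (n := n))
  rw [map_pow (incl F), map_pow (incl F), ← div_pow, ← ofPowerSeries_one_add_X, ← map_pow] at h4
  have hroot : (C (1 + X) * X ^ d - C X : F[X][X]).eval₂ (incl F)
      (HahnSeries.ofPowerSeries ℤ F σ) = 0 := by
    have := congrArg (HahnSeries.ofPowerSeries ℤ F) hσ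
    rw [map_mul, map_pow, ofPowerSeries_one_add_X, map_one, mul_div_assoc',
      div_eq_one_iff_eq (by rw [incl_X]; exact t_ne_zero)] at this
    simp only [eval₂_sub, eval₂_mul, eval₂_C, eval₂_pow, eval₂_X]
    linear_combination this
  have hdX : (1 + X : F[X]).natDegree ≤ 1 := by compute_degree
  have := hc _ _ _ _ 1 n (p ^ b) ⟨h2, hroot⟩ h1 h4 h3
    ((CoeffNatDegreeLE.C_mul_X_pow hdX d).sub (CoeffNatDegreeLE.of_C natDegree_X_le))
    ((CoeffNatDegreeLE.C_mul_X (by simp)).sub (CoeffNatDegreeLE.of_C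
      (by simpa using natDegree_pow_le_of_le n hdX)))
    (by rw [← map_sub]; exact habs)
  rw [hn] at this
  push_cast at this
  nlinarith

end Approximable

/-! ### Composites of Artin–Schreier and Kummer equations -/

section ArtinSchreierKummer

variable {F : Type*} [Field F]

/-- The polynomial `t ^ n (x ^ q - x) + (1 + t) ^ n`. -/
noncomputable def artinSchreierPoly (F : Type*) [Field F] (q n : ℕ) : F[X][X] :=
  C (X ^ n) * X ^ q + (C (-X ^ n) * X ^ 1 + C ((1 + X) ^ n))

/-- The numerator of `(x ^ q - x + (1 + t⁻¹) ^ n) ^ m - (1 + t⁻¹) ^ (-Q)`. -/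
noncomputable def artinSchreierKummerPoly (F : Type*) [Field F] (q m n Q : ℕ) : F[X][X] :=
  C ((1 + X) ^ Q) * artinSchreierPoly F q n ^ m + C (-X ^ (n * m + Q))

lemma artinSchreierPoly_natDegree {q : ℕ} (n : ℕ) (hq : 1 < q) :
    (artinSchreierPoly F q n).natDegree = q ∧ (artinSchreierPoly F q n).leadingCoeff = X ^ n := by
  have hX : (X ^ n : F[X]) ≠ 0 := pow_ne_zero _ X_ne_zero
  have hl : (C (-X ^ n) * X ^ 1 + C ((1 + X) ^ n) : F[X][X]).natDegree <
      (C (X ^ n) * X ^ q : F[X][X]).natDegree := by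
    rw [natDegree_C_mul_X_pow _ _ hX]
    have : (C (-X ^ n) * X ^ 1 + C ((1 + X) ^ n) : F[X][X]).natDegree ≤ 1 := by
      generalize (-X ^ n : F[X]) = a
      generalize ((1 + X) ^ n : F[X]) = b
      compute_degree
    lia
  rw [artinSchreierPoly, natDegree_add_eq_left_of_natDegree_lt hl, natDegree_C_mul_X_pow _ _ hX,
    leadingCoeff_add_of_degree_lt' (degree_lt_degree hl), leadingCoeff_mul, leadingCoeff_C,
    leadingCoeff_X_pow, mul_one]
  exact ⟨rfl, rfl⟩

lemma artinSchreierKummerPoly_natDegree {q m : ℕ} (n Q : ℕ) (hq : 1 < q) (hm : m ≠ 0) :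
    (artinSchreierKummerPoly F q m n Q).natDegree = q * m ∧
      (artinSchreierKummerPoly F q m n Q).leadingCoeff = (1 + X) ^ Q * X ^ (n * m) := by
  obtain ⟨h1, h2⟩ := artinSchreierPoly_natDegree (F := F) n hq
  have hX : ((1 + X) ^ Q : F[X]) ≠ 0 := by
    rw [add_comm, ← C_1]; exact pow_ne_zero _ (X_add_C_ne_zero 1)
  have hd : (C ((1 + X) ^ Q) * artinSchreierPoly F q n ^ m).natDegree = q * m := by
    rw [natDegree_C_mul hX, natDegree_pow, h1, mul_comm]
  have hl : (C (-X ^ (n * m + Q)) : F[X][X]).natDegree <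
      (C ((1 + X) ^ Q) * artinSchreierPoly F q n ^ m).natDegree := by
    rw [hd, natDegree_C]
    exact Nat.mul_pos (by lia) (by lia)
  rw [artinSchreierKummerPoly, natDegree_add_eq_left_of_natDegree_lt hl, hd,
    leadingCoeff_add_of_degree_lt' (degree_lt_degree hl), leadingCoeff_mul, leadingCoeff_C,
    leadingCoeff_pow, h2, ← pow_mul]
  exact ⟨rfl, rfl⟩

lemma artinSchreierKummerPoly_coeff_zero {q : ℕ} (m n Q : ℕ) (hq : 1 < q) :
    (artinSchreierKummerPoly F q m n Q).coeff 0 =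
      (1 + X) ^ Q * (1 + X) ^ (n * m) - X ^ (n * m) * X ^ Q := by
  have h : (artinSchreierPoly F q n).eval 0 = (1 + X) ^ n := by
    simp [artinSchreierPoly, (show q ≠ 0 by lia)]
  rw [coeff_zero_eq_eval_zero, artinSchreierKummerPoly, eval_add, eval_mul, eval_pow, h, eval_C,
    eval_C]
  ring

lemma artinSchreierKummerPoly_coeffNatDegreeLE (q m n Q : ℕ) :
    CoeffNatDegreeLE (Q + n * m) (artinSchreierKummerPoly F q m n Q) := by
  have hdX : (1 + X : F[X]).natDegree ≤ 1 := by compute_degree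
  have h (j : ℕ) : ((1 + X) ^ j : F[X]).natDegree ≤ j := by
    simpa using natDegree_pow_le_of_le j hdX
  refine ((CoeffNatDegreeLE.of_C (h Q)).mul (CoeffNatDegreeLE.pow ?_ m)).add
    (CoeffNatDegreeLE.of_C ?_)
  · exact (CoeffNatDegreeLE.C_mul_X_pow (by simp) _).add
      ((CoeffNatDegreeLE.C_mul_X_pow (by simp) _).add (CoeffNatDegreeLE.of_C (h n)))
  · rw [natDegree_neg, natDegree_X_pow, add_comm]

lemma gaussNorm_artinSchreierPoly_le {r : F} {c B : ℝ} {q n : ℕ} (hq : 1 < q) (hc : 1 ≤ c)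
    (hB1 : 1 ≤ B) (hB : rootAbv r X ^ n * c ^ q ≤ B) :
    (artinSchreierPoly F q n).gaussNorm (rootAbv r) c ≤ B := by
  have hc0 : 0 < c := by linarith
  have h0 : 0 ≤ rootAbv r X := (rootAbv r).nonneg _
  refine gaussNorm_add_le hc0 ?_ (gaussNorm_add_le hc0 ?_ ?_)
  · rwa [gaussNorm_C_mul_X_pow, map_pow]
  · rw [gaussNorm_C_mul_X_pow, (rootAbv r).map_neg, map_pow]
    refine le_trans ?_ hB
    gcongr
  · rw [gaussNorm_C]
    exact (rootAbv_le_one _ _).trans hB1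

lemma isCoprime_pow_mul_pow {A : Type*} [CommRing A] {x y : A} (h : IsCoprime x y) (i j : ℕ) :
    IsCoprime (x ^ i * y ^ j) (x ^ i * x ^ j - y ^ j * y ^ i) := by
  rw [sub_eq_add_neg]
  refine IsCoprime.mul_left ?_ ?_
  · rw [add_comm]
    exact IsCoprime.add_mul_left_right
      (IsCoprime.neg_right ((h.pow (m := i) (n := j)).mul_right h.pow)) _
  · rw [← mul_neg]
    exact IsCoprime.add_mul_left_right ((h.symm.pow (m := j) (n := i)).mul_right h.symm.pow) _

/-- The degree of a factor is divisible by q by the Newton polygon at t = 0 (slope n/q, with p ∤ n),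
and by m by the one at t = -1 (slope Q/(q m), with Q a power of p). As q and m are coprime, no
intermediate degree remains. -/
lemma artinSchreierKummerPoly_irreducible {p q m n Q : ℕ} (hp : p.Prime) {a e : ℕ} (hq : q = p ^ a)
    (ha : a ≠ 0) (hQ : Q = p ^ e) (hm : ¬ p ∣ m) (hn : ¬ p ∣ n) :
    Irreducible (artinSchreierKummerPoly F q m n Q) := by
  have hq1 : 1 < q := by rw [hq]; exact Nat.one_lt_pow ha hp.one_lt
  have hm0 : m ≠ 0 := by rintro rfl; simp at hm
  have hn0 : n ≠ 0 := by rintro rfl; simp at hn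
  obtain ⟨hdeg, hlead⟩ := artinSchreierKummerPoly_natDegree (F := F) n Q hq1 hm0
  have hcoeff := artinSchreierKummerPoly_coeff_zero (F := F) m n Q hq1
  have hQ0 : Q ≠ 0 := by rw [hQ]; exact (pow_pos hp.pos _).ne'
  have hqm : q * m ≠ 0 := mul_ne_zero (by lia) hm0
  set P := artinSchreierKummerPoly F q m n Q with hPdef
  have hP0 : P ≠ 0 := by rintro h; rw [h] at hdeg; simp at hdeg; lia
  have hcast : ((q * m : ℕ) : ℝ) ≠ 0 := by exact_mod_cast hqm
  refine irreducible_of_natDegree_dvd (by lia) ?_ fun A B hAB => ?_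
  · rw [hlead, hcoeff]
    exact isCoprime_pow_mul_pow isCoprime_one_add_X_X _ _
  have hd1 : q * m ∣ A.natDegree * (n * m) := by
    have hc1 : (1 : ℝ) ≤ 2 ^ (((n * m : ℕ) : ℝ) / (q * m : ℕ)) :=
      Real.one_le_rpow one_le_two (by positivity)
    have hcq : ((2 : ℝ) ^ (((n * m : ℕ) : ℝ) / (q * m : ℕ))) ^ q = 2 ^ n := by
      rw [← Real.rpow_natCast, ← Real.rpow_mul two_pos.le, ← Real.rpow_natCast]
      congr 1
      have : (m : ℝ) ≠ 0 := by exact_mod_cast hm0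
      have : (q : ℝ) ≠ 0 := by exact_mod_cast (show q ≠ 0 by lia)
      push_cast
      field_simp
    refine dvd_natDegree_mul_of_gaussNorm_le (0 : F) hP0 hAB hdeg hqm ?_ ?_ ?_
    · rw [hcoeff]
      exact rootAbv_eq_one (by simp [hm0, hn0])
    · rw [hlead, (rootAbv (0 : F)).map_mul, rootAbv_eq_one (by simp), one_mul, map_pow, rootAbv_X]
    · set c : ℝ := 2 ^ (((n * m : ℕ) : ℝ) / (q * m : ℕ))
      have hc0 : 0 < c := by linarith
      have hg := gaussNorm_artinSchreierPoly_le (r := (0 : F)) (n := n) hq1 hc1 le_rfl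
        (by rw [rootAbv_X, hcq, ← mul_pow]; norm_num)
      refine gaussNorm_add_le hc0 ?_ ?_
      · rw [gaussNorm_mul (rootAbv_isNonarchimedean _) hc0, gaussNorm_C, gaussNorm_pow hc0]
        exact mul_le_one₀ (rootAbv_le_one _ _) (pow_nonneg (gaussNorm_nonneg _ _ hc0.le) _)
          (pow_le_one₀ (gaussNorm_nonneg _ _ hc0.le) hg)
      · rw [gaussNorm_C]; exact rootAbv_le_one _ _
  have hd2 : q * m ∣ A.natDegree * Q := by
    have hc1 : (1 : ℝ) ≤ 2 ^ ((Q : ℝ) / (q * m : ℕ)) :=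
      Real.one_le_rpow one_le_two (by positivity)
    have hcq : (((2 : ℝ) ^ ((Q : ℝ) / (q * m : ℕ))) ^ q) ^ m = 2 ^ Q := by
      rw [← pow_mul, ← Real.rpow_natCast, ← Real.rpow_mul two_pos.le, div_mul_cancel₀ _ hcast,
        Real.rpow_natCast]
    refine dvd_natDegree_mul_of_gaussNorm_le (-1 : F) hP0 hAB hdeg hqm ?_ ?_ ?_
    · rw [hcoeff]
      exact rootAbv_eq_one (by simp [hQ0])
    · rw [hlead, (rootAbv (-1 : F)).map_mul, map_pow, rootAbv_one_add_X,
        rootAbv_eq_one (a := X ^ (n * m)) (by simp), mul_one]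
    · set c : ℝ := 2 ^ ((Q : ℝ) / (q * m : ℕ))
      have hc0 : 0 < c := by linarith
      -- Here t is a unit, so the Artin–Schreier factor has norm at most c^q, compensated by the
      -- factor (1 + t)^Q.
      have hg := gaussNorm_artinSchreierPoly_le (r := (-1 : F)) (n := n) (B := c ^ q) hq1 hc1
        (one_le_pow₀ hc1) (mul_le_of_le_one_left (by positivity)
          (pow_le_one₀ ((rootAbv _).nonneg _) (rootAbv_le_one _ _)))
      refine gaussNorm_add_le hc0 ?_ ?_
      · rw [gaussNorm_mul (rootAbv_isNonarchimedean _) hc0, gaussNorm_C, gaussNorm_pow hc0,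
          map_pow, rootAbv_one_add_X]
        calc (2⁻¹ : ℝ) ^ Q * _ ^ m ≤ 2⁻¹ ^ Q * (c ^ q) ^ m := by
              gcongr
              exact gaussNorm_nonneg _ _ hc0.le
          _ = 1 := by rw [hcq, ← mul_pow]; norm_num
      · rw [gaussNorm_C]; exact rootAbv_le_one _ _
  rw [hdeg]
  have hcop (j : ℕ) : ¬ p ∣ j → ∀ i, Nat.Coprime (p ^ i) j := fun hj i =>
    Nat.Coprime.pow_left i ((Nat.Prime.coprime_iff_not_dvd hp).2 hj)
  refine Nat.Coprime.mul_dvd_of_dvd_of_dvd (by rw [hq]; exact hcop m hm a) ?_ ?_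
  · refine Nat.Coprime.dvd_of_dvd_mul_right (n := n) (by rw [hq]; exact hcop n hn a) ?_
    rw [← mul_assoc] at hd1
    exact Nat.dvd_of_mul_dvd_mul_right (by lia) hd1
  · refine Nat.Coprime.dvd_of_dvd_mul_right (n := Q) ?_ ((Dvd.intro_left q rfl).trans hd2)
    rw [hQ]
    exact (hcop m hm e).symm

lemma artinSchreierKummerPoly_eval₂ {q m n Q : ℕ} {ξ : PowerSeries F}
    (h : (ξ ^ q - ξ + (1 + PowerSeries.X) ^ n) ^ m * (1 + PowerSeries.X) ^ Q = 1) :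
    (artinSchreierKummerPoly F q m n Q).eval₂ (incl F) (HahnSeries.ofPowerSeries ℤ F ξ) = 0 := by
  have h1 := congrArg (HahnSeries.ofPowerSeries ℤ F) h
  have ht := t_ne_zero (F := F)
  simp only [map_mul, map_pow, map_sub, map_add _ (ξ ^ q - ξ), map_one,
    ofPowerSeries_one_add_X] at h1
  have hu : incl F (1 + X) = t F * (incl F (1 + X) / incl F X) := by
    rw [incl_X]; field_simp
  simp only [artinSchreierKummerPoly, artinSchreierPoly, eval₂_add, eval₂_mul, eval₂_pow, eval₂_C,
    eval₂_X, eval₂_neg, map_pow, map_neg, incl_X]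
  rw [incl_X] at h1 hu
  set u := incl F (1 + X) / t F
  set x := HahnSeries.ofPowerSeries ℤ F ξ
  rw [hu]
  have e : t F ^ n * x ^ q + (-t F ^ n * x ^ 1 + (t F * u) ^ n) =
      t F ^ n * (x ^ q - x + u ^ n) := by
    ring
  rw [e, mul_pow, mul_pow, ← pow_mul]
  linear_combination (t F ^ Q * t F ^ (n * m)) * h1

/-- The numerator of `∑ i < k + 1, (1 + t⁻¹) ^ (n * q ^ i)`. -/
noncomputable def sumNumerator (F : Type*) [Field F] (q n k : ℕ) : F[X] :=
  ∑ i ∈ Finset.range (k + 1), (1 + X) ^ (n * q ^ i) * X ^ (n * (q ^ k - q ^ i))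

lemma sumNumerator_natDegree_le {q n k : ℕ} (hq : 0 < q) :
    (sumNumerator F q n k).natDegree ≤ n * q ^ k := by
  refine natDegree_sum_le_of_forall_le _ _ fun i hi => ?_
  have hik : q ^ i ≤ q ^ k := Nat.pow_le_pow_right hq (by have := Finset.mem_range.1 hi; lia)
  have h1 : ((1 + X) ^ (n * q ^ i) : F[X]).natDegree ≤ n * q ^ i := by
    have : (1 + X : F[X]).natDegree ≤ 1 := by compute_degree
    simpa using natDegree_pow_le_of_le (n * q ^ i) this
  refine (natDegree_mul_le_of_le h1 (natDegree_X_pow_le _)).trans ?_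
  rw [← mul_add, Nat.add_sub_cancel' hik]

/-- Only the last term, i = k, of the numerator is not divisible by t. -/
lemma sumNumerator_coprime {q n k : ℕ} (hq : 1 < q) (hn : n ≠ 0) :
    IsCoprime (X : F[X]) (sumNumerator F q n k) := by
  rw [irreducible_X.coprime_iff_not_dvd, X_dvd_iff, coeff_zero_eq_eval_zero, sumNumerator,
    Finset.sum_range_succ, eval_add, eval_finsetSum, Finset.sum_eq_zero]
  · simp
  · intro i hi
    have : q ^ i < q ^ k := Nat.pow_lt_pow_right hq (Finset.mem_range.1 hi)
    have : n * (q ^ k - q ^ i) ≠ 0 := mul_ne_zero hn (by lia)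
    simp [this]

lemma sumNumerator_div {q n k : ℕ} (hq : 0 < q) :
    incl F (sumNumerator F q n k) / incl F (X ^ (n * q ^ k)) =
      HahnSeries.ofPowerSeries ℤ F
        (∑ i ∈ Finset.range (k + 1), ((1 + PowerSeries.X) ^ n) ^ q ^ i) := by
  have ht := t_ne_zero (F := F)
  rw [sumNumerator, map_sum, map_sum, Finset.sum_div]
  refine Finset.sum_congr rfl fun i hi => ?_
  have hik : q ^ i ≤ q ^ k := Nat.pow_le_pow_right hq (by have := Finset.mem_range.1 hi; lia)
  have h : n * q ^ k = n * q ^ i + n * (q ^ k - q ^ i) := by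
    rw [← mul_add, Nat.add_sub_cancel' hik]
  simp only [map_pow, map_mul, ofPowerSeries_one_add_X]
  rw [← pow_mul, h, incl_X, pow_add, div_pow]
  field_simp

lemma le_snd_of_mem_D_mul {p : ℕ} [Fact p.Prime] [CharP F p] {a m : ℕ} (ha : a ≠ 0) (hm : ¬ p ∣ m)
    {w : ℝ × ℝ} (hw : w ∈ D F (p ^ a * m) 1) :
    ((p ^ a * m : ℕ) : ℝ) ≤ w.2 := by
  have hp : p.Prime := Fact.out
  obtain ⟨c, hc⟩ := exists_lt_of_mem_D hw
  have hm0 : m ≠ 0 := by rintro rfl; simp at hm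
  by_contra! hlt
  set q := p ^ a with hq
  have hq1 : 1 < q := Nat.one_lt_pow ha hp.one_lt
  -- This n makes u q < n (q m - v): the share u Q of log H(ξ) is then beaten by the gain in the
  -- exponent of H(α).
  obtain ⟨N, hN⟩ := exists_nat_gt ((w.1 * q) / ((q * m : ℕ) - w.2))
  obtain ⟨n, b, hNn, hb, hn⟩ := exists_large_quotient hp hm (N + 1)
  have hn0 : n ≠ 0 := by lia
  have hN' : (w.1 * q) / ((q * m : ℕ) - w.2) < n :=
    hN.trans_le (by exact_mod_cast (by lia))
  rw [div_lt_iff₀ (by linarith)] at hN'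
  have hpn : ¬ p ∣ n := by
    intro h
    have h1 : p ∣ m * n + 1 := by rw [← hn]; exact dvd_pow_self _ hb
    have h2 : p ∣ 1 := (Nat.dvd_add_right (Dvd.dvd.mul_left h m)).1 h1
    exact hp.one_lt.ne' (Nat.dvd_one.1 h2)
  -- Chosen after n: the remaining share u n m of log H(ξ) is absorbed by the extra Q in (m n + 1)
  -- Q, and Q ≥ k.
  obtain ⟨k, hk⟩ := exists_nat_gt (w.1 * (n * m) - c)
  obtain ⟨σ, hσ, hσ1⟩ := exists_pow_mul_eq_one (F := F) m
    (by rwa [ne_eq, CharP.cast_eq_zero_iff F p])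
  have : CharP (PowerSeries F) p :=
    charP_of_injective_algebraMap (algebraMap F (PowerSeries F)).injective p
  set r : PowerSeries F := (1 + PowerSeries.X) ^ n with hr
  set Q := q ^ (k + 1) with hQ
  have hQp : Q = p ^ (a * (k + 1)) := by rw [hQ, hq, pow_mul]
  have hdvd := pow_dvd_pow_of_dvd (X_pow_dvd_sub_pow hn hσ hσ1) Q
  rw [← pow_mul, ← hr] at hdvd
  -- Here (σ - r)^Q = σ^Q - r^Q, so ξ = s + δ solves ξ^q - ξ + r = σ^Q, and δ is the approximation
  -- error.
  obtain ⟨δ, hδ, hδX⟩ := exists_artinSchreier_root (p := p) ha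
    (mul_ne_zero (pow_pos hp.pos _).ne' (pow_pos (by lia) _).ne') hdvd
  set s : PowerSeries F := ∑ i ∈ Finset.range (k + 1), r ^ q ^ i with hs
  have hsum : s ^ q - s = r ^ Q - r := sum_pow_char_pow_sub a r (k + 1)
  have hξ : ((s + δ) ^ q - (s + δ) + r) ^ m * (1 + PowerSeries.X) ^ Q = 1 := by
    have h1 : (s + δ) ^ q - (s + δ) + r = σ ^ Q := by
      rw [hQp, sub_pow_char_pow, ← hQp] at hδ
      rw [hq, add_pow_char_pow, ← hq]
      linear_combination hsum + hδ
    rw [h1, ← pow_mul, mul_comm Q m, pow_mul, ← mul_pow, hσ, one_pow]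
  have hroot := artinSchreierKummerPoly_eval₂ hξ
  have hirr := artinSchreierKummerPoly_irreducible (F := F) hp hq ha hQp hm hpn
  obtain ⟨hdeg, -⟩ := artinSchreierKummerPoly_natDegree (F := F) n Q hq1 hm0
  obtain ⟨h3, h4⟩ := isMinimalPolynomial_linear (pow_ne_zero (n * q ^ k) X_ne_zero)
    (sumNumerator_coprime (F := F) hq1 hn0).pow_left
  rw [sumNumerator_div (by lia)] at h4
  have := hc _ _ _ _ (Q + n * m) (n * q ^ k) (p ^ b * Q) ⟨hirr, hroot⟩ hdeg h4 h3
    (artinSchreierKummerPoly_coeffNatDegreeLE _ _ _ _)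
    ((CoeffNatDegreeLE.C_mul_X (by simp)).sub
      (CoeffNatDegreeLE.of_C (sumNumerator_natDegree_le (by lia))))
    (by
      rw [← map_sub, ← hr, ← hs, add_sub_cancel_left]
      exact abv_ofPowerSeries_le_of_dvd hδX)
  have hkQ : (k : ℝ) ≤ Q := by
    have h1 : k < q ^ k := Nat.lt_pow_self hq1
    have h2 : q ^ k ≤ Q := Nat.pow_le_pow_right (by lia) (by lia)
    exact_mod_cast (h1.trans_le h2).le
  rw [hn] at this
  have hQq : (Q : ℝ) = q * q ^ k := by rw [hQ]; push_cast; ring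
  have hqk : (0 : ℝ) < (q : ℝ) ^ k := by positivity
  have hfin := mul_lt_mul_of_pos_right hN' hqk
  push_cast at this hfin
  rw [hQq] at this hkQ
  linarith

lemma le_snd_of_mem_D {p : ℕ} [Fact p.Prime] [CharP F p] {d : ℕ} (hd : d ≠ 0)
    {w : ℝ × ℝ} (hw : w ∈ D F d 1) : (d : ℝ) ≤ w.2 := by
  have hp : p.Prime := Fact.out
  obtain ⟨a, m, hm, rfl⟩ := Nat.exists_eq_pow_mul_and_not_dvd hd p hp.ne_one
  rcases eq_or_ne a 0 with rfl | ha
  · rw [pow_zero, one_mul] at hw ⊢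
    exact le_snd_of_mem_D_of_not_dvd hm hw
  · exact le_snd_of_mem_D_mul ha hm hw

end ArtinSchreierKummer

/-! ### The exact set in positive characteristic. -/

section PositiveCharacteristic

variable {F : Type*} [Field F]

lemma mem_D_of_le {d : ℕ} (hd : 2 ≤ d) {w : ℝ × ℝ} (h1 : 1 ≤ w.1) (h2 : (d : ℝ) ≤ w.2) :
    w ∈ D F d 1 := by
  have hd' : (2 : ℝ) ≤ d := by exact_mod_cast hd
  -- The constant 1/2 turns the non-strict Liouville bound into a strict one.
  refine ⟨by linarith, by linarith, 1 / 2, by norm_num, fun ξ α P R hP hPd hR hRd => ?_⟩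
  have hl := liouville hP hPd hd hR hRd
  have hHP := one_le_height_of_irreducible hP.irreducible
  have hHR := one_le_height_of_irreducible hR.irreducible
  rw [div_lt_iff₀ (by positivity), ← abv_apply]
  refine lt_of_lt_of_le (b := 1) (by norm_num) (hl.trans ?_)
  have h0 : 0 ≤ abv F (ξ - α) := (abv F).nonneg _
  gcongr
  · exact Real.self_le_rpow_of_one_le hHP h1
  · rw [← Real.rpow_natCast]
    exact Real.rpow_le_rpow_of_exponent_le hHR h2

/-- In positive characteristic the Liouville bound is optimal. -/
theorem D_eq_of_charP {p : ℕ} (hp : 0 < p) [CharP F p] {d : ℕ} (hd : 2 ≤ d) :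
    D F d 1 = {w : ℝ × ℝ | 1 ≤ w.1 ∧ (d : ℝ) ≤ w.2} := by
  have : Fact p.Prime := ⟨(CharP.char_is_prime_or_zero F p).resolve_right hp.ne'⟩
  ext w
  exact ⟨fun hw => ⟨one_le_fst_of_mem_D hd hw, le_snd_of_mem_D (p := p) (by lia) hw⟩,
    fun hw => mem_D_of_le hd hw.1 hw.2⟩

end PositiveCharacteristic

/-! ### The Euler derivation -/

section Euler

variable {F : Type*} [Field F]

/-- The underlying function of the derivation `t d/dt`. -/
noncomputable def eulerFun (x : K F) : K F where
  -- The k-th coefficient belongs to t^(-k), whence the sign.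
  coeff k := -(k : F) * x.coeff k
  isPWO_support' := x.isPWO_support.mono fun k hk => by
    rw [Function.mem_support] at hk
    exact right_ne_zero_of_mul hk

lemma eulerFun_coeff (x : K F) (k : ℤ) : (eulerFun x).coeff k = -(k : F) * x.coeff k := rfl

lemma eulerFun_support (x : K F) : (eulerFun x).support ⊆ x.support := fun k hk => by
  rw [HahnSeries.mem_support, eulerFun_coeff] at hk
  exact right_ne_zero_of_mul hk

lemma eulerFun_mul (x y : K F) : eulerFun (x * y) = x * eulerFun y + y * eulerFun x := by
  ext k
  -- All three products are expanded over the supports of x and y, which contain those of their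
  -- images, so that the sums compare termwise.
  rw [mul_comm y, HahnSeries.coeff_add, eulerFun_coeff, HahnSeries.coeff_mul,
    HahnSeries.coeff_mul_left' x.isPWO_support (eulerFun_support x),
    HahnSeries.coeff_mul_right' y.isPWO_support (eulerFun_support y), Finset.mul_sum,
    ← Finset.sum_add_distrib]
  refine Finset.sum_congr rfl fun ij hij => ?_
  have : k = ij.1 + ij.2 := (Finset.mem_antidiagonal.1 hij).2.2.symm
  rw [eulerFun_coeff, eulerFun_coeff, this]
  push_cast
  ring

lemma eulerFun_add (x y : K F) : eulerFun (x + y) = eulerFun x + eulerFun y := by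
  ext k
  rw [HahnSeries.coeff_add, eulerFun_coeff, eulerFun_coeff, eulerFun_coeff, HahnSeries.coeff_add,
    mul_add]

/-- An additive map satisfying the Leibniz rule, as a derivation. -/
def derivationOfLeibniz {A : Type*} [CommRing A] (f : A → A) (h1 : ∀ x y, f (x + y) = f x + f y)
    (h2 : ∀ x y, f (x * y) = x * f y + y * f x) : Derivation ℤ A A :=
  Derivation.mk' (AddMonoidHom.mk' f h1).toIntLinearMap h2

lemma derivation_mul {A : Type*} [CommRing A] (θ : Derivation ℤ A A) (x y : A) :
    θ (x * y) = x * θ y + y * θ x :=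
  θ.leibniz x y

lemma derivation_pow {A : Type*} [CommRing A] (θ : Derivation ℤ A A) (x : A) (n : ℕ) :
    θ (x ^ n) = n * (x ^ (n - 1) * θ x) := by
  rw [θ.leibniz_pow, nsmul_eq_mul, smul_eq_mul]

/-- The derivation `t d/dt` of `F((t⁻¹))`. -/
noncomputable def euler (F : Type*) [Field F] :=
  derivationOfLeibniz (A := K F) eulerFun eulerFun_add eulerFun_mul

lemma euler_coeff (x : K F) (k : ℤ) : (euler F x).coeff k = -(k : F) * x.coeff k := rfl

/-- The derivation acts diagonally on coefficients and cannot enlarge the leading exponent. Hence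
differentiated coefficients of P still have size at most H(P). -/
lemma abv_euler_le (x : K F) : abv F (euler F x) ≤ abv F x := by
  by_cases h : euler F x = 0
  · rw [h, map_zero]; exact (abv F).nonneg _
  have hx : x ≠ 0 := by rintro rfl; simp at h
  rw [abv_of_ne h, abv_of_ne hx]
  refine zpow_le_zpow_right₀ one_le_two (neg_le_neg (HahnSeries.order_le_of_coeff_ne_zero ?_))
  have := HahnSeries.coeff_order_eq_zero.not.2 h
  rw [euler_coeff] at this
  exact right_ne_zero_of_mul this

lemma euler_C (a : F) : euler F (HahnSeries.C a) = 0 := by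
  ext k
  rw [euler_coeff, HahnSeries.C_apply, HahnSeries.coeff_single]
  split_ifs with h <;> simp [h]

lemma euler_t : euler F (t F) = t F := by
  ext k
  rw [euler_coeff, t, HahnSeries.coeff_single]
  split_ifs with h <;> simp [h]

lemma euler_incl (a : F[X]) : euler F (incl F a) = incl F (X * derivative a) := by
  induction a using Polynomial.induction_on' with
  | add p q hp hq => simp only [map_add, mul_add, hp, hq]
  | monomial n c =>
    rw [← C_mul_X_pow_eq_monomial, map_mul, map_pow, incl_C, incl_X, derivation_mul,
      derivation_pow, euler_C, euler_t, derivative_C_mul_X_pow]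
    rcases n with _ | n
    · simp
    · rw [mul_zero, add_zero, Nat.add_sub_cancel, C_mul, map_mul,
        map_mul, map_mul, map_pow, incl_C, incl_X, incl_C, map_natCast]
      ring

/-- In characteristic 0 the leading exponent of a series killed by t d/dt must vanish. -/
lemma abv_eq_one_of_euler_eq_zero [CharZero F] {x : K F} (hx : x ≠ 0) (h : euler F x = 0) :
    abv F x = 1 := by
  have h1 := congrArg (fun y => HahnSeries.coeff y x.order) h
  simp only [euler_coeff, HahnSeries.coeff_zero, mul_eq_zero, neg_eq_zero, Int.cast_eq_zero,
    HahnSeries.coeff_order_eq_zero, hx, or_false] at h1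
  rw [abv_of_ne hx, h1]
  simp

/-- Series with the same logarithmic derivative have the same absolute value. -/
lemma abv_eq_of_mul_euler_eq [CharZero F] {u v : K F} (hu : u ≠ 0) (hv : v ≠ 0)
    (h : v * euler F u = u * euler F v) : abv F u = abv F v := by
  obtain ⟨w, hw⟩ : ∃ w, u = w * v := ⟨u / v, (div_mul_cancel₀ u hv).symm⟩
  have hw0 : w ≠ 0 := by rintro rfl; rw [zero_mul] at hw; exact hu hw
  have : euler F w = 0 := by
    rw [hw, derivation_mul] at h
    have : v * v * euler F w = 0 := by linear_combination h
    simpa [hv] using this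
  rw [hw, (abv F).map_mul, abv_eq_one_of_euler_eq_zero hw0 this, one_mul]

end Euler

/-! ### The Riccati equation of a cubic -/

section Riccati

variable {A : Type*} [CommRing A]

/-- The discriminant of `a x³ + b x² + c x + d`. -/
def cubicDisc (a b c d : A) : A :=
  b * b * c * c - 4 * (a * c * c * c) - 4 * (b * b * b * d) - 27 * (a * a * d * d)
    + 18 * (a * b * c * d)

/-- The Hessian of `a x³ + b x² + c x + d`. -/
def hessian (a b c d x : A) : A :=
  (b ^ 2 - 3 * (a * c)) * x ^ 2 + (b * c - 9 * (a * d)) * x + (c ^ 2 - 3 * (b * d))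

/-- The quadratic coefficient of the Riccati equation of `a x³ + b x² + c x + d`. -/
def riccatiTwo (a b c d a' b' c' d' : A) : A :=
  6 * (a * a * c * d') - 9 * (a * a * d * c') - 2 * (a * b * b * d') + a * b * c * c'
    + 6 * (a * b * d * b') - 2 * (a * c * c * b') + 3 * (a * c * d * a') - 4 * (b * b * d * a')
    + b * c * c * a'

/-- The linear coefficient of the Riccati equation of `a x³ + b x² + c x + d`. -/
def riccatiOne (a b c d a' b' c' d' : A) : A :=
  7 * (a * b * c * d') - 9 * (a * a * d * d') - 3 * (a * b * d * c') - 2 * (a * c * c * c')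
    + 3 * (a * c * d * b') + 9 * (a * d * d * a') - 2 * (b * b * b * d') + b * b * c * c'
    + 2 * (b * b * d * b') - b * c * c * b' - 7 * (b * c * d * a') + 2 * (c * c * c * a')

/-- The constant coefficient of the Riccati equation of `a x³ + b x² + c x + d`. -/
def riccatiZero (a b c d a' b' c' d' : A) : A :=
  4 * (a * c * c * d') - 3 * (a * b * d * d') - 6 * (a * c * d * c') + 9 * (a * d * d * b')
    - b * b * c * d' + 2 * (b * b * d * c') - b * c * d * b' - 6 * (b * d * d * a')
    + 2 * (c * c * d * a')

/-- The logarithmic derivative, times the discriminant, of `a x³ + b x² + c x + d` along a solution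
of its Riccati equation. -/
def riccatiMultiplier (a b c d a' b' c' d' x : A) : A :=
  (18 * (a * a * c * d') - 27 * (a * a * d * c') - 6 * (a * b * b * d') + 3 * (a * b * c * c')
    + 18 * (a * b * d * b') - 6 * (a * c * c * b') + 9 * (a * c * d * a') - 12 * (b * b * d * a')
    + 3 * (b * c * c * a')) * x
  + (15 * (a * b * c * d') - 27 * (a * a * d * d') - 6 * (a * c * c * c') + 9 * (a * c * d * b')
    - 4 * (b * b * b * d') + 2 * (b * b * c * c') - b * c * c * b' - 6 * (b * c * d * a')
    + 2 * (c * c * c * a'))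

/-- Modulo P, the Riccati quadratic is -Δ P^θ / P', where θ acts on the coefficients in P^θ. At a
root, P^θ + P' θ(x) = 0 turns this into the Riccati equation. -/
lemma cubicDisc_mul_add_eq (a b c d a' b' c' d' x : A) :
    cubicDisc a b c d * (a' * x ^ 3 + b' * x ^ 2 + c' * x + d') +
      (3 * a * x ^ 2 + 2 * b * x + c) * (riccatiTwo a b c d a' b' c' d' * x ^ 2 +
        riccatiOne a b c d a' b' c' d' * x + riccatiZero a b c d a' b' c' d') =
      (a * x ^ 3 + b * x ^ 2 + c * x + d) * riccatiMultiplier a b c d a' b' c' d' x := by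
  simp only [cubicDisc, riccatiTwo, riccatiOne, riccatiZero, riccatiMultiplier]
  ring

variable (θ : Derivation ℤ A A)

/-- The derivative of a cubic polynomial at an arbitrary point. -/
lemma derivation_cubic (a b c d x : A) :
    θ (a * x ^ 3 + b * x ^ 2 + c * x + d) = (θ a * x ^ 3 + θ b * x ^ 2 + θ c * x + θ d) +
      (3 * a * x ^ 2 + 2 * b * x + c) * θ x := by
  simp only [map_add, Derivation.leibniz, Derivation.leibniz_pow, smul_eq_mul, nsmul_eq_mul]
  push_cast
  ring

/-- A root of a cubic polynomial satisfies its Riccati equation. -/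
lemma riccati_of_root [IsDomain A] {a b c d x : A} (h0 : a * x ^ 3 + b * x ^ 2 + c * x + d = 0)
    (h1 : 3 * a * x ^ 2 + 2 * b * x + c ≠ 0) :
    cubicDisc a b c d * θ x = riccatiTwo a b c d (θ a) (θ b) (θ c) (θ d) * x ^ 2 +
        riccatiOne a b c d (θ a) (θ b) (θ c) (θ d) * x +
        riccatiZero a b c d (θ a) (θ b) (θ c) (θ d) := by
  have h2 := derivation_cubic θ a b c d x
  have h3 := cubicDisc_mul_add_eq a b c d (θ a) (θ b) (θ c) (θ d) x
  rw [h0, map_zero] at h2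
  rw [h0, zero_mul] at h3
  rw [← sub_eq_zero]
  refine (mul_eq_zero.1 ?_).resolve_left h1
  linear_combination (-cubicDisc a b c d) * h2 - h3

/-- Along a solution of its Riccati equation, the quotient of `Δ P²` by the cube of the Hessian is
constant. -/
lemma hessian_mul_derivation [IsDomain A] {a b c d x : A} (hΔ : cubicDisc a b c d ≠ 0)
    (hx : cubicDisc a b c d * θ x = riccatiTwo a b c d (θ a) (θ b) (θ c) (θ d) * x ^ 2 +
        riccatiOne a b c d (θ a) (θ b) (θ c) (θ d) * x +
        riccatiZero a b c d (θ a) (θ b) (θ c) (θ d)) :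
    hessian a b c d x ^ 3 *
        θ (cubicDisc a b c d * (a * x ^ 3 + b * x ^ 2 + c * x + d) ^ 2) =
      (cubicDisc a b c d * (a * x ^ 3 + b * x ^ 2 + c * x + d) ^ 2) *
        θ (hessian a b c d x ^ 3) := by
  have h1 := derivation_cubic θ a b c d x
  have h2 := cubicDisc_mul_add_eq a b c d (θ a) (θ b) (θ c) (θ d) x
  have h3 : cubicDisc a b c d * θ (a * x ^ 3 + b * x ^ 2 + c * x + d) =
      (a * x ^ 3 + b * x ^ 2 + c * x + d) *
        riccatiMultiplier a b c d (θ a) (θ b) (θ c) (θ d) x := by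
    rw [h1]
    linear_combination (3 * a * x ^ 2 + 2 * b * x + c) * hx + h2
  -- With h3, this gives Δ P² and Hess³ the same logarithmic derivative, (θ(Δ) + 2 * multiplier) /
  -- Δ.
  have h4 : 3 * (cubicDisc a b c d * θ (hessian a b c d x)) = hessian a b c d x *
      (θ (cubicDisc a b c d) + 2 * riccatiMultiplier a b c d (θ a) (θ b) (θ c) (θ d) x) := by
    have c3 : θ (3 : A) = 0 := θ.map_natCast 3
    have c4 : θ (4 : A) = 0 := θ.map_natCast 4
    have c9 : θ (9 : A) = 0 := θ.map_natCast 9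
    have c18 : θ (18 : A) = 0 := θ.map_natCast 18
    have c27 : θ (27 : A) = 0 := θ.map_natCast 27
    have e1 : θ (hessian a b c d x) =
        (2 * b * θ b - 3 * (a * θ c + c * θ a)) * x ^ 2
          + (b * θ c + c * θ b - 9 * (a * θ d + d * θ a)) * x
          + (2 * c * θ c - 3 * (b * θ d + d * θ b))
          + (2 * (b ^ 2 - 3 * (a * c)) * x + (b * c - 9 * (a * d))) * θ x := by
      simp only [hessian, map_add, map_sub, Derivation.leibniz, Derivation.leibniz_pow,
        smul_eq_mul, nsmul_eq_mul, c3, c9]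
      push_cast
      ring
    have e2 : θ (cubicDisc a b c d) =
        2 * b * c ^ 2 * θ b + 2 * b ^ 2 * c * θ c - 4 * (c ^ 3 * θ a + 3 * a * c ^ 2 * θ c)
          - 4 * (3 * b ^ 2 * d * θ b + b ^ 3 * θ d)
          - 27 * (2 * a * d ^ 2 * θ a + 2 * a ^ 2 * d * θ d)
          + 18 * (b * c * d * θ a + a * c * d * θ b + a * b * d * θ c + a * b * c * θ d) := by
      simp only [cubicDisc, map_add, map_sub, Derivation.leibniz, smul_eq_mul, c4, c18, c27]
      ring
    rw [e1, e2]
    have e3 : 3 * (2 * (b ^ 2 - 3 * (a * c)) * x + (b * c - 9 * (a * d))) *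
        (cubicDisc a b c d * θ x) = 3 * (2 * (b ^ 2 - 3 * (a * c)) * x + (b * c - 9 * (a * d))) *
        (riccatiTwo a b c d (θ a) (θ b) (θ c) (θ d) * x ^ 2 +
        riccatiOne a b c d (θ a) (θ b) (θ c) (θ d) * x +
        riccatiZero a b c d (θ a) (θ b) (θ c) (θ d)) := by rw [hx]
    simp only [cubicDisc, hessian, riccatiTwo, riccatiOne, riccatiZero, riccatiMultiplier] at e3 ⊢
    linear_combination e3
  refine mul_left_cancel₀ hΔ ?_
  simp only [Derivation.leibniz, Derivation.leibniz_pow, smul_eq_mul, nsmul_eq_mul]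
  push_cast
  generalize cubicDisc a b c d = D at *
  generalize a * x ^ 3 + b * x ^ 2 + c * x + d = y at *
  generalize hessian a b c d x = h at *
  linear_combination (2 * h ^ 3 * D * y) * h3 - (D * y ^ 2 * h ^ 2) * h4

section Map

variable {B : Type*} [CommRing B] (f : A →+* B)

lemma map_cubicDisc (a b c d : A) :
    f (cubicDisc a b c d) = cubicDisc (f a) (f b) (f c) (f d) := by
  simp [cubicDisc, map_ofNat]

lemma map_riccatiTwo (a b c d a' b' c' d' : A) : f (riccatiTwo a b c d a' b' c' d') =
    riccatiTwo (f a) (f b) (f c) (f d) (f a') (f b') (f c') (f d') := by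
  simp [riccatiTwo, map_ofNat]

lemma map_riccatiOne (a b c d a' b' c' d' : A) : f (riccatiOne a b c d a' b' c' d') =
    riccatiOne (f a) (f b) (f c) (f d) (f a') (f b') (f c') (f d') := by
  simp [riccatiOne, map_ofNat]

lemma map_riccatiZero (a b c d a' b' c' d' : A) : f (riccatiZero a b c d a' b' c' d') =
    riccatiZero (f a) (f b) (f c) (f d) (f a') (f b') (f c') (f d') := by
  simp [riccatiZero, map_ofNat]

end Map

section Mem

lemma ofNat_mul_mem {S : AddSubgroup A} (n : ℕ) [n.AtLeastTwo] {x : A} (hx : x ∈ S) :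
    OfNat.ofNat n * x ∈ S := by
  have := S.nsmul_mem hx n
  rwa [nsmul_eq_mul] at this

variable {S : AddSubgroup A} {T : Set A} {a b c d a' b' c' d' : A}
  (h : ∀ x ∈ T, ∀ y ∈ T, ∀ z ∈ T, ∀ w ∈ T, x * y * z * w ∈ S) (ha : a ∈ T) (hb : b ∈ T)
  (hc : c ∈ T) (hd : d ∈ T) (ha' : a' ∈ T) (hb' : b' ∈ T) (hc' : c' ∈ T) (hd' : d' ∈ T)

-- Each monomial is an integer times a product of four coefficients or derivatives of coefficients;
-- this is the source of the exponent 4 of H(ξ).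
include h ha hb hc hd in
lemma cubicDisc_mem : cubicDisc a b c d ∈ S := by
  unfold cubicDisc
  repeat' first
    | apply ofNat_mul_mem
    | apply S.add_mem
    | apply S.sub_mem
    | apply h
  all_goals assumption

include h ha hb hc hd ha' hb' hc' hd'

lemma riccatiTwo_mem : riccatiTwo a b c d a' b' c' d' ∈ S := by
  unfold riccatiTwo
  repeat' first
    | apply ofNat_mul_mem
    | apply S.add_mem
    | apply S.sub_mem
    | apply h
  all_goals assumption

lemma riccatiOne_mem : riccatiOne a b c d a' b' c' d' ∈ S := by
  unfold riccatiOne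
  repeat' first
    | apply ofNat_mul_mem
    | apply S.add_mem
    | apply S.sub_mem
    | apply h
  all_goals assumption

end Mem

/-- A cubic polynomial of discriminant zero with a simple root also has a double root. -/
lemma exists_double_root {k : Type*} [Field k] [CharZero k] {a b c d x : k} (ha : a ≠ 0)
    (h0 : a * x ^ 3 + b * x ^ 2 + c * x + d = 0) (h1 : 3 * a * x ^ 2 + 2 * b * x + c ≠ 0)
    (hΔ : cubicDisc a b c d = 0) :
    ∃ y, a * y ^ 3 + b * y ^ 2 + c * y + d = 0 ∧ 3 * a * y ^ 2 + 2 * b * y + c = 0 := by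
  have hd : d = -(a * x ^ 3 + b * x ^ 2 + c * x) := by linear_combination h0
  -- The discriminant is P'(x)² times that of the quadratic quotient of P by the root x, whose
  -- double root is -(a x + b)/(2 a).
  have h3 : (3 * a * x ^ 2 + 2 * b * x + c) ^ 2 *
      ((3 * a * x + b) ^ 2 - 4 * (a * (3 * a * x ^ 2 + 2 * b * x + c))) = 0 := by
    rw [← hΔ, hd, cubicDisc]; ring
  have h4 := (mul_eq_zero.1 h3).resolve_left (pow_ne_zero 2 h1)
  obtain ⟨y, hy⟩ : ∃ y, 2 * a * y = -(a * x + b) :=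
    ⟨-(a * x + b) / (2 * a), mul_div_cancel₀ _ (mul_ne_zero two_ne_zero ha)⟩
  have hc : 4 * a * c = b ^ 2 - 3 * a ^ 2 * x ^ 2 - 2 * a * b * x := by linear_combination -h4
  refine ⟨y, ?_, ?_⟩
  · have e1 : (2 * a * y) ^ 3 = (-(a * x + b)) ^ 3 := by rw [hy]
    have e2 : (2 * a * y) ^ 2 = (-(a * x + b)) ^ 2 := by rw [hy]
    have : 8 * a ^ 2 * (a * y ^ 3 + b * y ^ 2 + c * y + d) = 0 := by
      rw [hd]
      linear_combination e1 + 2 * b * e2 + (b ^ 2 - 3 * a ^ 2 * x ^ 2 - 2 * a * b * x) * hy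
        + (2 * a * y - 2 * a * x) * hc
    exact (mul_eq_zero.1 this).resolve_left (mul_ne_zero (by norm_num) (pow_ne_zero 2 ha))
  · have : 4 * a * (3 * a * y ^ 2 + 2 * b * y + c) = 0 := by
      linear_combination (3 * (2 * a * y) - 3 * (a * x + b) + 4 * b) * hy + hc
    exact (mul_eq_zero.1 this).resolve_left (mul_ne_zero (by norm_num) ha)

/-- The Taylor expansions at a root of the invariants of a cubic polynomial. -/
lemma cubic_taylor {a b c d x p₁ p₂ : A} (y : A) (h0 : a * x ^ 3 + b * x ^ 2 + c * x + d = 0)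
    (hp₁ : p₁ = 3 * a * x ^ 2 + 2 * b * x + c) (hp₂ : p₂ = 3 * a * x + b) :
    cubicDisc a b c d = p₁ ^ 2 * (p₂ ^ 2 - 4 * (a * p₁)) ∧
    hessian a b c d (x + y) =
      p₁ ^ 2 + (p₁ * (p₂ * y) + ((p₂ * y) ^ 2 - 3 * (a * y ^ 2 * p₁))) ∧
    a * (x + y) ^ 3 + b * (x + y) ^ 2 + c * (x + y) + d = y * (p₁ + (p₂ * y + a * y ^ 2)) := by
  have hd : d = -(a * x ^ 3 + b * x ^ 2 + c * x) := by linear_combination h0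
  subst hd hp₁ hp₂
  refine ⟨?_, ?_, ?_⟩
  · rw [cubicDisc]; ring
  · rw [hessian]; ring
  · ring

end Riccati

/-! ### Rational approximation of cubic series in characteristic zero -/

section Cubic

variable {F : Type*} [Field F]

lemma abv_ofNat_mul_le {x : K F} {B : ℝ} (n : ℕ) [n.AtLeastTwo] (h : abv F x ≤ B) :
    abv F (OfNat.ofNat n * x) ≤ B := by
  rw [(abv F).map_mul]
  exact (mul_le_of_le_one_left ((abv F).nonneg _) (abv_natCast_le n)).trans h

lemma abv_mul_le {x y : K F} {B C : ℝ} (hx : abv F x ≤ B) (hy : abv F y ≤ C) :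
    abv F (x * y) ≤ B * C := by
  rw [(abv F).map_mul]
  exact mul_le_mul hx hy ((abv F).nonneg _) (((abv F).nonneg _).trans hx)

lemma abv_mul_mul_mul_le {x y z w : K F} {H : ℝ} (hx : abv F x ≤ H) (hy : abv F y ≤ H)
    (hz : abv F z ≤ H) (hw : abv F w ≤ H) : abv F (x * y * z * w) ≤ H ^ 4 :=
  (abv_mul_le (abv_mul_le (abv_mul_le hx hy) hz) hw).trans_eq (by ring)

/-- The closed ball of radius `B` around zero. -/
noncomputable def closedBallSubgroup (F : Type*) [Field F] {B : ℝ} (hB : 0 ≤ B) :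
    AddSubgroup (K F) where
  carrier := {x | abv F x ≤ B}
  zero_mem' := by rw [Set.mem_ofPred_eq, map_zero]; exact hB
  add_mem' := abv_add_le
  neg_mem' := fun {x} hx => by rw [Set.mem_ofPred_eq, (abv F).map_neg]; exact hx

/-- A root of a cubic polynomial is at most its height. -/
lemma abv_root_le {a b c d x : K F} {H : ℝ} (hH : 1 ≤ H) (ha : 1 ≤ abv F a) (hb : abv F b ≤ H)
    (hc : abv F c ≤ H) (hd : abv F d ≤ H) (h0 : a * x ^ 3 + b * x ^ 2 + c * x + d = 0) :
    abv F x ≤ H := by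
  by_contra! h
  have hx1 : 1 ≤ abv F x := hH.trans h.le
  have h1 : a * x ^ 3 = -(b * x ^ 2 + c * x + d) := by linear_combination h0
  have h2 : abv F (b * x ^ 2 + c * x + d) ≤ H * abv F x ^ 2 := by
    refine abv_add_le (abv_add_le ?_ ?_) ?_
    · rw [(abv F).map_mul, map_pow]; gcongr
    · rw [(abv F).map_mul]
      gcongr
      exact le_self_pow₀ hx1 two_ne_zero
    · exact hd.trans (le_mul_of_one_le_right (by linarith) (one_le_pow₀ hx1))
  rw [← (abv F).map_neg, ← h1, (abv F).map_mul, map_pow] at h2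
  have h3 : abv F x * abv F x ^ 2 ≤ H * abv F x ^ 2 := by
    calc _ = 1 * abv F x ^ 3 := by ring
      _ ≤ abv F a * abv F x ^ 3 := by gcongr
      _ ≤ _ := h2
  exact absurd (le_of_mul_le_mul_right h3 (by positivity)) h.not_ge

/-- A solution of the Riccati equation of a cubic polynomial is not close to a root. -/
lemma one_le_abv_sub_of_riccati [CharZero F] {a b c d x z : K F} {H : ℝ} (hH : 1 ≤ H)
    (ha : abv F a ≤ H) (hb : abv F b ≤ H) (hc : abv F c ≤ H) (hx : abv F x ≤ H)
    (h0 : a * x ^ 3 + b * x ^ 2 + c * x + d = 0)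
    (hΔ : 1 ≤ abv F (cubicDisc a b c d))
    (hz0 : a * z ^ 3 + b * z ^ 2 + c * z + d ≠ 0)
    (hz : cubicDisc a b c d * euler F z =
      riccatiTwo a b c d (euler F a) (euler F b) (euler F c) (euler F d) * z ^ 2 +
        riccatiOne a b c d (euler F a) (euler F b) (euler F c) (euler F d) * z +
        riccatiZero a b c d (euler F a) (euler F b) (euler F c) (euler F d)) :
    1 ≤ abv F (x - z) * H ^ 4 := by
  by_contra! hlt
  obtain ⟨y, rfl⟩ : ∃ y, z = x + y := ⟨z - x, by ring⟩
  rw [sub_add_cancel_left, (abv F).map_neg] at hlt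
  have hΔ0 : cubicDisc a b c d ≠ 0 := by
    intro h; rw [h, map_zero] at hΔ; linarith
  obtain ⟨p₁, hp₁⟩ : ∃ p, p = 3 * a * x ^ 2 + 2 * b * x + c := ⟨_, rfl⟩
  obtain ⟨p₂, hp₂⟩ : ∃ p, p = 3 * a * x + b := ⟨_, rfl⟩
  obtain ⟨hΔeq, hheq, hyeq⟩ := cubic_taylor y h0 hp₁ hp₂
  have hH0 : 0 < H := by linarith
  have hp₂H : abv F p₂ ≤ H ^ 2 := by
    rw [hp₂]
    refine abv_add_le ?_ (hb.trans (le_self_pow₀ hH two_ne_zero))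
    rw [mul_assoc]
    exact abv_ofNat_mul_le 3 ((abv_mul_le ha hx).trans_eq (by ring))
  have hp₁H : abv F p₁ ≤ H ^ 3 := by
    rw [hp₁]
    refine abv_add_le (abv_add_le ?_ ?_) (hc.trans (le_self_pow₀ hH three_ne_zero))
    · rw [mul_assoc, sq]
      exact abv_ofNat_mul_le 3 ((abv_mul_le ha (abv_mul_le hx hx)).trans_eq (by ring))
    · rw [mul_assoc]
      refine abv_ofNat_mul_le 2 ((abv_mul_le hb hx).trans ?_)
      rw [← sq]
      exact pow_le_pow_right₀ hH (by norm_num)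
  -- Since Δ = p₁² (p₂² - 4 a p₁) has size at least 1 and the second factor at most H^4, the
  -- derivative p₁ = P'(x) is at least H^(-2).
  have hp₁low : 1 ≤ abv F p₁ * H ^ 2 := by
    have h1 : abv F (p₂ ^ 2 - 4 * (a * p₁)) ≤ (H ^ 2) ^ 2 := by
      refine abv_sub_le ?_ (abv_ofNat_mul_le 4 ((abv_mul_le ha hp₁H).trans_eq (by ring)))
      rw [map_pow]
      gcongr
    rw [hΔeq, (abv F).map_mul, map_pow] at hΔ
    have h2 : 1 ≤ (abv F p₁ * H ^ 2) ^ 2 := by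
      rw [mul_pow]
      exact hΔ.trans (by gcongr)
    by_contra! h3
    exact absurd h2 (pow_lt_one₀ (by positivity) h3 two_ne_zero).not_ge
  have hp₁pos : 0 < abv F p₁ := by
    by_contra! h
    have : abv F p₁ * H ^ 2 ≤ 0 := mul_nonpos_of_nonpos_of_nonneg h (by positivity)
    linarith
  have hyH : abv F y * H ^ 2 < abv F p₁ := by
    refine lt_of_mul_lt_mul_right (a := H ^ 2) ?_ (by positivity)
    calc _ = abv F y * H ^ 4 := by ring
      _ < 1 := hlt
      _ ≤ _ := hp₁low
  have hy0 : 0 ≤ abv F y := (abv F).nonneg _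
  have hlt₂ : abv F (p₂ * y) < abv F p₁ := by
    rw [(abv F).map_mul, mul_comm]
    exact lt_of_le_of_lt (by gcongr) hyH
  have hlt₁ : abv F (a * y ^ 2) < abv F p₁ := by
    have hy1 : abv F y ≤ 1 := by
      by_contra! h
      have : 1 * 1 ≤ abv F y * H ^ 4 := mul_le_mul h.le (one_le_pow₀ hH) zero_le_one hy0
      linarith
    rw [(abv F).map_mul, map_pow]
    refine lt_of_le_of_lt ?_ hyH
    calc abv F a * abv F y ^ 2 ≤ H ^ 2 * abv F y := by
          gcongr
          · exact ha.trans (le_self_pow₀ hH two_ne_zero)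
          · exact pow_le_of_le_one hy0 hy1 two_ne_zero
      _ = _ := mul_comm _ _
  have hsq₂ : abv F ((p₂ * y) ^ 2) < abv F (p₁ ^ 2) := by
    rw [map_pow, map_pow]
    exact pow_lt_pow_left₀ hlt₂ ((abv F).nonneg _) two_ne_zero
  have hmul₁ : abv F (a * y ^ 2 * p₁) < abv F (p₁ ^ 2) := by
    rw [(abv F).map_mul _ p₁, map_pow, pow_two (abv F p₁)]
    exact mul_lt_mul_of_pos_right hlt₁ hp₁pos
  -- As y is small against p₁, the first Taylor term dominates: |Hess| = |p₁|² and |P(z)| = |y|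
  -- |p₁|.
  have hhabs : abv F (hessian a b c d (x + y)) = abv F p₁ ^ 2 := by
    rw [hheq, abv_add_eq_left, map_pow]
    refine abv_add_lt ?_ ?_
    · rw [(abv F).map_mul p₁, map_pow, pow_two (abv F p₁)]
      exact mul_lt_mul_of_pos_left hlt₂ hp₁pos
    · rw [sub_eq_add_neg]
      refine abv_add_lt hsq₂ ?_
      rw [(abv F).map_neg]
      exact (abv_ofNat_mul_le 3 le_rfl).trans_lt hmul₁
  have hyabs : abv F (a * (x + y) ^ 3 + b * (x + y) ^ 2 + c * (x + y) + d) =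
      abv F y * abv F p₁ := by
    rw [hyeq, (abv F).map_mul, abv_add_eq_left (abv_add_lt hlt₂ hlt₁)]
  have hh0 : hessian a b c d (x + y) ≠ 0 := by
    intro h
    rw [h, map_zero] at hhabs
    exact (pow_pos hp₁pos 2).ne hhabs
  -- The constancy of Δ P² / Hess³ gives |p₂² - 4 a p₁| |y|² = |p₁|², which the smallness of y
  -- forbids.
  have key := abv_eq_of_mul_euler_eq (mul_ne_zero hΔ0 (pow_ne_zero 2 hz0)) (pow_ne_zero 3 hh0)
    (hessian_mul_derivation (euler F) hΔ0 hz)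
  rw [(abv F).map_mul, map_pow, map_pow, hyabs, hhabs, hΔeq, (abv F).map_mul, map_pow] at key
  have hfin : abv F ((p₂ * y) ^ 2 - 4 * (a * y ^ 2 * p₁)) < abv F (p₁ ^ 2) := by
    rw [sub_eq_add_neg]
    refine abv_add_lt hsq₂ ?_
    rw [(abv F).map_neg]
    exact (abv_ofNat_mul_le 4 le_rfl).trans_lt hmul₁
  have e : (p₂ * y) ^ 2 - 4 * (a * y ^ 2 * p₁) = (p₂ ^ 2 - 4 * (a * p₁)) * y ^ 2 := by ring
  rw [e, (abv F).map_mul, map_pow, map_pow] at hfin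
  have : abv F p₁ ^ 4 * (abv F (p₂ ^ 2 - 4 * (a * p₁)) * abv F y ^ 2) <
      abv F p₁ ^ 4 * abv F p₁ ^ 2 := by gcongr
  nlinarith

lemma eval₂_cubic {P : F[X][X]} (hd : P.natDegree = 3) (x : K F) :
    P.eval₂ (incl F) x = incl F (P.coeff 3) * x ^ 3 + incl F (P.coeff 2) * x ^ 2 +
      incl F (P.coeff 1) * x + incl F (P.coeff 0) := by
  rw [eval₂_eq_sum_range, hd]
  simp only [Finset.sum_range_succ, Finset.sum_range_zero]
  ring

lemma derivative_eval₂_cubic {P : F[X][X]} (hd : P.natDegree = 3) (x : K F) :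
    P.derivative.eval₂ (incl F) x = 3 * incl F (P.coeff 3) * x ^ 2 + 2 * incl F (P.coeff 2) * x +
      incl F (P.coeff 1) := by
  rw [eval₂_eq_sum_range' (incl F) (n := 3)
    (by have := natDegree_derivative_lt (p := P) (by lia); lia)]
  simp only [Finset.sum_range_succ, Finset.sum_range_zero, coeff_derivative, map_mul, map_add,
    map_natCast, map_one]
  push_cast
  ring

/-- The value at a rational function of the Riccati equation of a polynomial over `F[t]`, multiplied
by the square of the denominator, is a polynomial. -/
lemma exists_incl_eq_riccati {α : K F} (p q f g h k : F[X]) (hq : incl F q * α = incl F p) :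
    ∃ e : F[X], incl F e = incl F q ^ 2 *
      (cubicDisc (incl F f) (incl F g) (incl F h) (incl F k) * euler F α -
      (riccatiTwo (incl F f) (incl F g) (incl F h) (incl F k) (euler F (incl F f))
        (euler F (incl F g)) (euler F (incl F h)) (euler F (incl F k)) * α ^ 2 +
      riccatiOne (incl F f) (incl F g) (incl F h) (incl F k) (euler F (incl F f))
        (euler F (incl F g)) (euler F (incl F h)) (euler F (incl F k)) * α +
      riccatiZero (incl F f) (incl F g) (incl F h) (incl F k) (euler F (incl F f))
        (euler F (incl F g)) (euler F (incl F h)) (euler F (incl F k)))) := by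
  have hqθ : incl F q ^ 2 * euler F α =
      incl F q * incl F (X * derivative p) - incl F p * incl F (X * derivative q) := by
    have := congrArg (euler F) hq
    rw [derivation_mul, euler_incl, euler_incl] at this
    linear_combination incl F q * this - incl F (X * derivative q) * hq
  simp only [euler_incl, ← map_cubicDisc, ← map_riccatiTwo, ← map_riccatiOne, ← map_riccatiZero]
  generalize cubicDisc f g h k = Δ
  generalize riccatiTwo f g h k (X * derivative f) (X * derivative g) (X * derivative h)
    (X * derivative k) = r₂
  generalize riccatiOne f g h k (X * derivative f) (X * derivative g) (X * derivative h)
    (X * derivative k) = r₁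
  generalize riccatiZero f g h k (X * derivative f) (X * derivative g) (X * derivative h)
    (X * derivative k) = r₀
  refine ⟨Δ * (q * (X * derivative p) - p * (X * derivative q)) -
    (r₂ * p ^ 2 + r₁ * (p * q) + r₀ * q ^ 2), ?_⟩
  generalize X * derivative p = p' at *
  generalize X * derivative q = q' at *
  simp only [map_sub, map_add, map_mul, map_pow]
  rw [← hqθ, ← hq]
  ring

/-- The distance from a root of a cubic polynomial to a point which does not satisfy its Riccati
equation. -/
lemma abv_riccati_le {a b c d x z : K F} {H M : ℝ} (hH : 0 ≤ H) (hM : 1 ≤ M)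
    (ha : abv F a ≤ H) (hb : abv F b ≤ H) (hc : abv F c ≤ H) (hd : abv F d ≤ H)
    (hx : abv F x ≤ M) (hz : abv F z ≤ M)
    (hric : cubicDisc a b c d * euler F x =
      riccatiTwo a b c d (euler F a) (euler F b) (euler F c) (euler F d) * x ^ 2 +
        riccatiOne a b c d (euler F a) (euler F b) (euler F c) (euler F d) * x +
        riccatiZero a b c d (euler F a) (euler F b) (euler F c) (euler F d)) :
    abv F (cubicDisc a b c d * euler F z -
      (riccatiTwo a b c d (euler F a) (euler F b) (euler F c) (euler F d) * z ^ 2 +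
        riccatiOne a b c d (euler F a) (euler F b) (euler F c) (euler F d) * z +
        riccatiZero a b c d (euler F a) (euler F b) (euler F c) (euler F d))) ≤
      abv F (x - z) * (H ^ 4 * M) := by
  have hS : ∀ x ∈ {x | abv F x ≤ H}, ∀ y ∈ {x | abv F x ≤ H}, ∀ z ∈ {x | abv F x ≤ H},
      ∀ w ∈ {x | abv F x ≤ H}, x * y * z * w ∈ closedBallSubgroup F (pow_nonneg hH 4) :=
    fun x hx y hy z hz w hw => abv_mul_mul_mul_le hx hy hz hw
  have ha' := (abv_euler_le a).trans ha
  have hb' := (abv_euler_le b).trans hb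
  have hc' := (abv_euler_le c).trans hc
  have hd' := (abv_euler_le d).trans hd
  have hΔ : abv F _ ≤ H ^ 4 := cubicDisc_mem hS ha hb hc hd
  have h2 : abv F _ ≤ H ^ 4 := riccatiTwo_mem hS ha hb hc hd ha' hb' hc' hd'
  have h1 : abv F _ ≤ H ^ 4 := riccatiOne_mem hS ha hb hc hd ha' hb' hc' hd'
  have hH4 : 0 ≤ H ^ 4 := pow_nonneg hH 4
  have h0 : 0 ≤ abv F (x - z) := (abv F).nonneg _
  revert hric hΔ h2 h1
  generalize riccatiTwo a b c d (euler F a) (euler F b) (euler F c) (euler F d) = q₂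
  generalize riccatiOne a b c d (euler F a) (euler F b) (euler F c) (euler F d) = q₁
  generalize riccatiZero a b c d (euler F a) (euler F b) (euler F c) (euler F d) = q₀
  generalize cubicDisc a b c d = Δ
  intro hric hΔ h2 h1
  -- Subtracting the equation satisfied by x cancels q₀, which therefore needs no bound.
  have e : Δ * euler F z - (q₂ * z ^ 2 + q₁ * z + q₀) =
      (x - z) * (q₂ * (x + z) + q₁) - Δ * euler F (x - z) := by
    rw [map_sub]
    linear_combination hric
  rw [e]
  refine abv_sub_le (abv_mul_le le_rfl (abv_add_le (abv_mul_le h2 (abv_add_le hx hz)) ?_)) ?_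
  · exact h1.trans (le_mul_of_one_le_right hH4 hM)
  · refine (abv_mul_le hΔ (abv_euler_le _)).trans ?_
    rw [mul_comm]
    gcongr
    exact le_mul_of_one_le_right hH4 hM

/-- The effective approximation theorem for cubic series in characteristic zero. -/
lemma one_le_abv_sub_cubic [CharZero F] {P R : F[X][X]} {ξ α : K F} (hP : IsMinimalPolynomial P ξ)
    (hd : P.natDegree = 3) (hR : IsMinimalPolynomial R α) (hR1 : R.natDegree = 1) :
    1 ≤ abv F (ξ - α) * (height P ^ 4 * height R ^ 2) := by
  have hHP := one_le_height_of_irreducible hP.irreducible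
  have hHR := one_le_height_of_irreducible hR.irreducible
  rcases lt_or_ge (max 1 (abv F α)) (abv F ξ) with h | hM
  · exact one_le_mul_of_one_le_of_one_le (one_le_abv_sub_of_lt h)
      (one_le_mul_of_one_le_of_one_le (one_le_pow₀ hHP) (one_le_pow₀ hHR))
  have hlc : P.coeff 3 ≠ 0 := by
    rw [← hd]; exact leadingCoeff_ne_zero.2 hP.irreducible.ne_zero
  have hK : CharZero (K F) := charZero_of_injective_ringHom (HahnSeries.C : F →+* K F).injective
  have h0 := hP.root
  have hcommon (x : K F) (hx : P.eval₂ (incl F) x = 0) :=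
    derivative_eval₂_ne_zero hP.irreducible (by lia) hx
  have h1 := hcommon ξ h0
  obtain ⟨hq, hα⟩ := eq_div_of_natDegree_eq_one hR1 hR.root
  have hq' : incl F (R.coeff 1) ≠ 0 := by rwa [ne_eq, map_eq_zero_iff _ incl_injective]
  have hα0 := eval₂_div_ne_zero hP.irreducible (by lia) (-R.coeff 0) (R.coeff 1)
  have hqM := abv_denominator_mul_max_le hR1 hR.root
  rw [← hα] at hα0
  simp only [eval₂_cubic hd, derivative_eval₂_cubic hd] at h0 h1 hcommon hα0
  have hH (i : ℕ) := abv_coeff_le_height P i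
  have ha1 := one_le_abv_incl hlc
  have ha0 : incl F (P.coeff 3) ≠ 0 := by rwa [ne_eq, map_eq_zero_iff _ incl_injective]
  -- A zero discriminant would give P and P' a common root, against separability.
  have hdisc : 1 ≤ abv F (cubicDisc (incl F (P.coeff 3)) (incl F (P.coeff 2)) (incl F (P.coeff 1))
      (incl F (P.coeff 0))) := by
    rw [← map_cubicDisc]
    refine one_le_abv_incl fun hzero => ?_
    have h2 := map_cubicDisc (incl F) (P.coeff 3) (P.coeff 2) (P.coeff 1) (P.coeff 0)
    rw [hzero, map_zero] at h2
    obtain ⟨η, hη0, hη1⟩ := exists_double_root ha0 h0 h1 h2.symm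
    exact hcommon η hη0 hη1
  have hric := riccati_of_root (euler F) h0 h1
  have hξH := abv_root_le hHP ha1 (hH 2) (hH 1) (hH 0) h0
  obtain ⟨e, he⟩ := exists_incl_eq_riccati (α := α) (-R.coeff 0) (R.coeff 1) (P.coeff 3) (P.coeff 2)
    (P.coeff 1) (P.coeff 0) (by rw [hα, mul_div_cancel₀ _ hq'])
  have hy0 : 0 ≤ abv F (ξ - α) := (abv F).nonneg _
  -- Whether α itself satisfies the Riccati equation decides which of the two estimates applies.
  by_cases he0 : e = 0
  · rw [he0, map_zero] at he
    have hz := sub_eq_zero.1 ((mul_eq_zero.1 he.symm).resolve_left (pow_ne_zero 2 hq'))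
    refine (one_le_abv_sub_of_riccati hHP (hH 3) (hH 2) (hH 1) hξH h0 hdisc hα0 hz).trans ?_
    gcongr
    exact le_mul_of_one_le_right (by positivity) (one_le_pow₀ hHR)
  · have h3 := one_le_abv_incl he0
    rw [he, (abv F).map_mul, map_pow] at h3
    have hM1 : 1 ≤ max 1 (abv F α) := le_max_left _ _
    have h5 := abv_riccati_le (by linarith) hM1 (hH 3) (hH 2) (hH 1) (hH 0) hM
      (le_max_right 1 (abv F α)) hric
    have h6 := h3.trans (mul_le_mul_of_nonneg_left h5 (by positivity))
    clear h5 h3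
    generalize max 1 (abv F α) = M at *
    have hA : 0 ≤ abv F (incl F (R.coeff 1)) := (abv F).nonneg _
    generalize abv F (incl F (R.coeff 1)) = A at *
    calc 1 ≤ A ^ 2 * (abv F (ξ - α) * (height P ^ 4 * M)) := h6
      _ ≤ A ^ 2 * (abv F (ξ - α) * (height P ^ 4 * M ^ 2)) := by
          gcongr
          exact le_self_pow₀ hM1 two_ne_zero
      _ = abv F (ξ - α) * (height P ^ 4 * (A * M) ^ 2) := by ring
      _ ≤ _ := by gcongr

lemma mem_D_cubic [CharZero F] {w : ℝ × ℝ} (h1 : 4 ≤ w.1) (h2 : 2 ≤ w.2) : w ∈ D F 3 1 := by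
  refine ⟨by linarith, by linarith, 1 / 2, by norm_num, fun ξ α P R hP hPd hR hRd => ?_⟩
  have hl := one_le_abv_sub_cubic hP hPd hR hRd
  have hHP := one_le_height_of_irreducible hP.irreducible
  have hHR := one_le_height_of_irreducible hR.irreducible
  rw [div_lt_iff₀ (by positivity), ← abv_apply]
  refine lt_of_lt_of_le (b := 1) (by norm_num) (hl.trans ?_)
  have h0 : 0 ≤ abv F (ξ - α) := (abv F).nonneg _
  gcongr
  · rw [← Real.rpow_natCast]
    exact Real.rpow_le_rpow_of_exponent_le hHP (by exact_mod_cast h1)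
  · rw [← Real.rpow_natCast]
    exact Real.rpow_le_rpow_of_exponent_le hHR (by exact_mod_cast h2)

end Cubic

end DistancedSeries

theorem theorem4 (F : Type*) [Field F] :
    (∀ p : ℕ, 0 < p → CharP F p → ∀ d : ℕ, 2 ≤ d →
      DistancedSeries.D F d 1 = {w : ℝ × ℝ | 1 ≤ w.1 ∧ (d : ℝ) ≤ w.2}) ∧
    (CharZero F →
      (∀ v : ℝ, 2 ≤ v → v ≤ 3 →
        (DistancedSeries.D F 3 1 ∩ DistancedSeries.line v).Nonempty) ∧
      ((4, 2) : ℝ × ℝ) ∈ DistancedSeries.D F 3 1) :=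
  ⟨fun _ hp _ _ hd => DistancedSeries.D_eq_of_charP hp hd, fun _ =>
    -- Raising v only weakens the inequality, because heights are at least 1; so (4, 2) brings the
    -- whole half-line above it.
    ⟨fun v hv _ => ⟨(4, v), DistancedSeries.mem_D_cubic le_rfl hv, rfl⟩,
      DistancedSeries.mem_D_cubic le_rfl le_rfl⟩⟩
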